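/- Let $N\ge 3$, let $q=\frac1N\Big(\frac{2}{1+\sqrt{1-4/N^2}}\Big)\in(0,1)$, and write $[x]_q=\frac{q^{-x}-q^{x}}{q^{-1}-q}=q^{-(x-1)}\frac{1-q^{2x}}{1-q^2}$ and $[x]_q!=[x]_q[x-1]_q\cdots[1]_q$. Let $(e_i)_{i=1}^N$ be the standard basis of $H_1=\mathbb C^N$ and $T_1=\sum_i e_i\otimes e_i$. Let $p_k$ be the Jones–Wenzl projection on $(\mathbb C^N)^{\otimes k}$, given by $p_0=\iota$, $p_1=\iota$ and, for $k\ge2$, $$p_k=\iota_{H_1}\otimes p_{k-1}-\tfrac{[k-1]_q}{[k]_q}(\iota_{H_1}\otimes p_{k-1})(T_1T_1^*\otimes\iota_{H_1^{\otimes k-2}})(\iota_{H_1}\otimes p_{k-1}),$$ and let $H_k=p_k(\mathbb C^N)^{\otimes k}$ (the $k$-th irreducible representation space of the free orthogonal quantum group $O_N^+$). Let $k,l,m\in\mathbb N_0$ with $k=l+m-2r$ for an integer $1\le r\le\min\{l,m\}$ (an admissible, non-highest-weight triple). Put $T_r=\sum_{i_1,\dots,i_r}e_{i_1}\otimes\cdots\otimes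 e_{i_r}\otimes e_{i_r}\otimes\cdots\otimes e_{i_1}$, $$A_k^{l,m}=(p_l\otimes p_m)(\iota_{H_1^{\otimes(l-r)}}\otimes T_r\otimes\iota_{H_1^{\otimes(m-r)}})p_k:H_k\to H_l\otimes H_m,\qquad \alpha_k^{l,m}=\|A_k^{l,m}\|^{-1}A_k^{l,m},$$ $$\theta_q(k,l,m)=\frac{[r]_q!\,[l-r]_q!\,[m-r]_q!\,[k+r+1]_q!}{[l]_q!\,[m]_q!\,[k]_q!},\qquad C(q)=(1-q^2)^{-1/2}\Big(\prod_{s=1}^\infty\frac1{1-q^{2s}}\Big)^{3/2}.$$ For $t\ge0$ let $\Phi_t:\mathcal B(H_l)\to\mathcal B(H_m)$ be the unique linear map whose Choi matrix $\sum_{i,j}e_{ij}\otimes\Phi_t(e_{ij})$, formed with the matrix units $e_{ij}$ of any given orthonormal basis of $H_l$, is $\iota_{H_l\otimes H_m}-t\,\alpha_k^{l,m}(\alpha_k^{l,m})^*$. Then for every integer $d\ge1$: 1. if $1<t\le\dfrac{\theta_q(k,l,m)}{d\,[k+1]_q}$, then $\Phi_t$ is $d$-positive but not completely positive; 2. if $d\le(N-2)(N-1)^{\frac{l+m-k-2}{2}}$,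 then conversely $\Phi_t$ is $d$-positive but not completely positive only if $1<t\le\dfrac{\theta_q(k,l,m)}{d\,[k+1]_q}$; so for such $d$ this is an "if and only if"; 3. $\dfrac{\theta_q(k,l,m)}{d\,[k+1]_q}\ \ge\ C(q)^{-2}\,q^{-\frac{l+m-k}{2}}\,d^{-1}$. -/

import Mathlib

open scoped TensorProduct CStarAlgebra

namespace FreeOrth

noncomputable section

/-! ### Quantum numbers -/

/-- The quantum parameter `q = (1/N) · 2 / (1 + √(1 - 4/N²))`. -/
def qParam (N : ℕ) : ℝ :=
  1 / (N : ℝ) * (2 / (1 + Real.sqrt (1 - 4 / (N : ℝ) ^ 2)))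

/-- The quantum integer `[x]_q = (q^{-x} - q^x) / (q^{-1} - q)
= q^{-(x-1)} (1 - q^{2x}) / (1 - q²)`. -/
def qInt (q : ℝ) (x : ℕ) : ℝ :=
  (q⁻¹ ^ x - q ^ x) / (q⁻¹ - q)

/-- The quantum factorial `[x]_q! = [x]_q ⋯ [2]_q [1]_q`. -/
def qFact (q : ℝ) (x : ℕ) : ℝ :=
  ∏ s ∈ Finset.range x, qInt q (s + 1)

/-- The value of the `θ`-net `θ_q(k, l, m)`, where `k = l + m - 2 r`. -/
def theta (q : ℝ) (k l m r : ℕ) : ℝ :=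
  (qFact q r * qFact q (l - r) * qFact q (m - r) * qFact q (k + r + 1)) /
    (qFact q l * qFact q m * qFact q k)

/-- The constant `C(q) = (1 - q²)^{-1/2} (∏_{s ≥ 1} 1 / (1 - q^{2s}))^{3/2}`. -/
def constC (q : ℝ) : ℝ :=
  (1 - q ^ 2) ^ (-(1 / 2) : ℝ) * (∏' s : ℕ, 1 / (1 - q ^ (2 * (s + 1)))) ^ (3 / 2 : ℝ)

/-- The infinite product in `C(q)` converges for `0 ≤ q < 1`. -/
theorem multipliable_constC {q : ℝ} (h0 : 0 ≤ q) (h1 : q < 1) :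
    Multipliable fun s : ℕ => 1 / (1 - q ^ (2 * (s + 1))) := by
  have hq2 : q ^ 2 < 1 := by nlinarith
  have hle : ∀ s : ℕ, q ^ (2 * (s + 1)) ≤ q ^ 2 := fun s =>
    pow_le_pow_of_le_one h0 h1.le (by omega)
  have hs : Summable fun s : ℕ => 1 / (1 - q ^ (2 * (s + 1))) - 1 := by
    have hg : Summable fun s : ℕ => (1 - q ^ 2)⁻¹ * (q ^ 2) ^ s :=
      (summable_geometric_of_lt_one (by positivity) hq2).mul_left _
    refine Summable.of_nonneg_of_le (fun s => ?_) (fun s => ?_) hg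
    · have h2 : 0 ≤ q ^ (2 * (s + 1)) := by positivity
      have := hle s
      rw [sub_nonneg, le_div_iff₀ (by linarith)]
      linarith
    · have := hle s
      have h3 : q ^ (2 * (s + 1)) ≤ (q ^ 2) ^ s := by
        rw [← pow_mul]
        exact pow_le_pow_of_le_one h0 h1.le (by omega)
      have h4 : 1 / (1 - q ^ (2 * (s + 1))) - 1 =
          (1 - q ^ (2 * (s + 1)))⁻¹ * q ^ (2 * (s + 1)) := by
        have : 1 - q ^ (2 * (s + 1)) ≠ 0 := by linarith
        field_simp
        ring
      rw [h4]
      have h5 : 0 < 1 - q ^ 2 := by linarith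
      gcongr
  simpa using multipliable_one_add_of_summable hs.norm

/-! ### Tensor powers of `ℂ^N` and Jones-Wenzl projections -/

/-- The Hilbert space `(ℂ^N)^{⊗ k}`, in the coordinates given by its standard orthonormal basis
`e_{x 0} ⊗ ⋯ ⊗ e_{x (k-1)}`, `x : Fin k → Fin N`. -/
abbrev TPow (N k : ℕ) : Type := EuclideanSpace ℂ (Fin k → Fin N)

/-- The standard basis vector `e_{x 0} ⊗ ⋯ ⊗ e_{x (k-1)}`. -/
def stdVec {N k : ℕ} (x : Fin k → Fin N) : TPow N k := EuclideanSpace.single x 1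

/-- The matrix of `ι ⊗ A` on `ℂ^N ⊗ (ℂ^N)^{⊗ k}`. -/
def idTensor {N k : ℕ} (A : Matrix (Fin k → Fin N) (Fin k → Fin N) ℂ) :
    Matrix (Fin (k + 1) → Fin N) (Fin (k + 1) → Fin N) ℂ :=
  fun x y => if x 0 = y 0 then A (Fin.tail x) (Fin.tail y) else 0

/-- The matrix of `T₁ T₁^* ⊗ ι` on `(ℂ^N)^{⊗ 2} ⊗ (ℂ^N)^{⊗ k}`, where `T₁ = ∑ i, e_i ⊗ e_i`. -/
def cupCap (N k : ℕ) : Matrix (Fin (k + 2) → Fin N) (Fin (k + 2) → Fin N) ℂ :=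
  fun x y => if x 0 = x 1 ∧ y 0 = y 1 ∧ Fin.tail (Fin.tail x) = Fin.tail (Fin.tail y) then 1 else 0

/-- The Jones-Wenzl projections `p_k` on `(ℂ^N)^{⊗ k}`, through the Wenzl recursion
`p_k = ι ⊗ p_{k-1} - ([k-1]_q / [k]_q) (ι ⊗ p_{k-1}) (T₁ T₁^* ⊗ ι) (ι ⊗ p_{k-1})`. -/
def jonesWenzl (N : ℕ) : (k : ℕ) → Matrix (Fin k → Fin N) (Fin k → Fin N) ℂ
  | 0 => 1
  | 1 => 1
  | k + 2 =>
    idTensor (jonesWenzl N (k + 1)) -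
      ((qInt (qParam N) (k + 1) / qInt (qParam N) (k + 2) : ℝ) : ℂ) •
        (idTensor (jonesWenzl N (k + 1)) * cupCap N k * idTensor (jonesWenzl N (k + 1)))

/-- The operator `p_k` on `(ℂ^N)^{⊗ k}`. -/
def jwOp (N k : ℕ) : TPow N k →ₗ[ℂ] TPow N k := Matrix.toEuclideanLin (jonesWenzl N k)

/-- The range of `p_k` in `(ℂ^N)^{⊗ k}`. -/
def jwRange (N k : ℕ) : Submodule ℂ (TPow N k) := LinearMap.range (jwOp N k)

/-- The Hilbert space `H_k = p_k (ℂ^N)^{⊗ k}` of the `k`-th irreducible representation of the free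
orthogonal quantum group `O_N^+`, with the inner product of `(ℂ^N)^{⊗ k}`. -/
def HSpace (N k : ℕ) : Type := jwRange N k

instance (N k : ℕ) : NormedAddCommGroup (HSpace N k) :=
  inferInstanceAs (NormedAddCommGroup (jwRange N k))

instance (N k : ℕ) : InnerProductSpace ℂ (HSpace N k) :=
  inferInstanceAs (InnerProductSpace ℂ (jwRange N k))

instance (N k : ℕ) : FiniteDimensional ℂ (HSpace N k) :=
  inferInstanceAs (FiniteDimensional ℂ (jwRange N k))

instance (N k : ℕ) : CompleteSpace (HSpace N k) := FiniteDimensional.complete ℂ (HSpace N k)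

/-- The inclusion of `H_k` into `(ℂ^N)^{⊗ k}`. -/
def jwIncl (N k : ℕ) : HSpace N k →ₗ[ℂ] TPow N k := (jwRange N k).subtype

/-- `p_k`, regarded as a map onto `H_k`. -/
def jwProj (N k : ℕ) : TPow N k →ₗ[ℂ] HSpace N k := (jwOp N k).rangeRestrict

/-! ### Three-vertices and the equivariant isometries -/

/-- The map `ι_{l-r} ⊗ T_r ⊗ ι_{m-r} : (ℂ^N)^{⊗ k} → (ℂ^N)^{⊗ l} ⊗ (ℂ^N)^{⊗ m}` for
`k + 2 r = l + m`, where `T_r = ∑_i e_{i 0} ⊗ ⋯ ⊗ e_{i (r-1)} ⊗ e_{i (r-1)} ⊗ ⋯ ⊗ e_{i 0}`.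
The coefficient of `e_x ⊗ e_y` in the image of `e_z` is `1` if the first `l - r` letters of `x` are
the first `l - r` letters of `z`, the last `m - r` letters of `y` are the last `m - r` letters of
`z`, and the last `r` letters of `x` are the first `r` letters of `y` in reverse order;
otherwise it is `0`. -/
def insertT (N k l m r : ℕ) : TPow N k →ₗ[ℂ] TPow N l ⊗[ℂ] TPow N m :=
  ∑ x : Fin l → Fin N, ∑ y : Fin m → Fin N,
    ∑ z : Fin k → Fin N with
      ((∀ (i : Fin k) (j : Fin l), (j : ℕ) + r < l → (i : ℕ) = j → z i = x j) ∧
       (∀ (i : Fin k) (j : Fin m), r ≤ (j : ℕ) → (i : ℕ) + 2 * r = l + j → z i = y j) ∧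
       (∀ (i : Fin l) (j : Fin m), (j : ℕ) < r → (i : ℕ) + j + 1 = l → x i = y j)),
      (innerSL ℂ (stdVec z) : TPow N k →ₗ[ℂ] ℂ).smulRight (stdVec x ⊗ₜ[ℂ] stdVec y)

/-- The three-vertex `A_k^{l,m} = (p_l ⊗ p_m) (ι_{l-r} ⊗ T_r ⊗ ι_{m-r}) p_k`,
as a map `H_k → H_l ⊗ H_m`, where `k + 2 r = l + m`. -/
def threeVertex (N k l m r : ℕ) : HSpace N k →ₗ[ℂ] HSpace N l ⊗[ℂ] HSpace N m :=
  TensorProduct.map (jwProj N l) (jwProj N m) ∘ₗ insertT N k l m r ∘ₗ jwIncl N k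

/-- The isometry `α_k^{l,m} = ‖A_k^{l,m}‖⁻¹ A_k^{l,m}` (operator norm). -/
def alpha (N k l m r : ℕ) : HSpace N k →ₗ[ℂ] HSpace N l ⊗[ℂ] HSpace N m :=
  ((‖LinearMap.toContinuousLinearMap (threeVertex N k l m r)‖⁻¹ : ℝ) : ℂ) • threeVertex N k l m r

/-- The operator `α_k^{l,m} (α_k^{l,m})^*` on `H_l ⊗ H_m`. -/
def alphaProj (N k l m r : ℕ) :
    HSpace N l ⊗[ℂ] HSpace N m →ₗ[ℂ] HSpace N l ⊗[ℂ] HSpace N m :=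
  alpha N k l m r ∘ₗ LinearMap.adjoint (alpha N k l m r)

/-! ### Choi matrices and positivity of linear maps -/

/-- The Choi matrix `C_Φ = ∑ i j, e_{ij} ⊗ Φ (e_{ij})` of a linear map `Φ : B(H) → B(K)`, where
`e_{ij} = |b_i⟩⟨b_j|` are the matrix units of an orthonormal basis `b` of `H`. -/
def choi {ι H K : Type*} [Fintype ι] [NormedAddCommGroup H] [InnerProductSpace ℂ H]
    [NormedAddCommGroup K] [InnerProductSpace ℂ K] (b : OrthonormalBasis ι ℂ H)
    (Φ : (H →L[ℂ] H) →ₗ[ℂ] (K →L[ℂ] K)) : H ⊗[ℂ] K →ₗ[ℂ] H ⊗[ℂ] K :=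
  ∑ i, ∑ j, TensorProduct.map
    (InnerProductSpace.rankOne ℂ (b i) (b j) : H →L[ℂ] H).toLinearMap
    (Φ (InnerProductSpace.rankOne ℂ (b i) (b j))).toLinearMap

/-- `Φ : B(H) → B(K)` is `d`-positive: `id ⊗ Φ : M_d(B(H)) → M_d(B(K))` maps positive elements to
positive elements. -/
def IsDPositive {H K : Type*} [NormedAddCommGroup H] [InnerProductSpace ℂ H] [CompleteSpace H]
    [NormedAddCommGroup K] [InnerProductSpace ℂ K] [CompleteSpace K] (d : ℕ)
    (Φ : (H →L[ℂ] H) →ₗ[ℂ] (K →L[ℂ] K)) : Prop :=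
  ∀ M : CStarMatrix (Fin d) (Fin d) (H →L[ℂ] H), 0 ≤ M → 0 ≤ M.map Φ

/-- `Φ : B(H) → B(K)` is completely positive. -/
def IsCompletelyPositive {H K : Type*} [NormedAddCommGroup H] [InnerProductSpace ℂ H]
    [CompleteSpace H] [NormedAddCommGroup K] [InnerProductSpace ℂ K] [CompleteSpace K]
    (Φ : (H →L[ℂ] H) →ₗ[ℂ] (K →L[ℂ] K)) : Prop :=
  ∃ Ψ : (H →L[ℂ] H) →CP (K →L[ℂ] K), ∀ x, Ψ x = Φ x

end

end FreeOrth

namespace FreeOrth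

noncomputable section

/-! ### Quantum integers -/

/-! The three-vertex `A` is a multiple of an isometry: `‖A ξ‖² = ρ ‖ξ‖²` with `ρ = θ_q(k,l,m) /
[k+1]_q`. Hence the quadratic form of the Choi matrix at `v` is `‖v‖² - t ρ⁻¹ ‖A* v‖²`. By Choi's
theorem and its version for Schmidt rank, complete positivity means that this form is nonnegative at
all `v`, which for `t ≥ 0` is `t ≤ 1`. Likewise `d`-positivity means nonnegativity at all `v` of
Schmidt rank at most `d`. Everything reduces to the size of `A* v` for such `v`.

Upper bound. The projections fix vectors of `H_l` and `H_m`, so `⟪A ξ, η ⊗ ζ⟫` involves only the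
cups, and Cauchy-Schwarz bounds it by `‖ξ‖ ‖η‖ ‖ζ‖`, with constant 1 for every `r`
(`norm_inner_threeVertex_tmul_le`). Expanding along an orthonormal first leg then gives `‖A* v‖² ≤ d
‖v‖²` (`norm_sq_apply_sum_tmul_le`), so `t ≤ ρ / d` suffices.

Sharpness. Basis words without equal neighbouring letters lie in `H_k`. Fix such a word of length
`k`, cut it in two, and insert a word of length `r` after the left piece and its reverse before the
right piece. There are enough reduced choices to sum `d` orthonormal product vectors, each of
overlap 1 with the same unit vector (`exists_large_overlap`). The sum has norm `√d` and its image
under `A*` has norm at least `d`, which forces `t ≤ ρ / d`.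

Value of `ρ`. Add the cups one at a time. Applying the Wenzl recursion on both sides of a new cup
shows that inserting, projecting and contracting is a scalar, and that the scalar satisfies the
recursion of `thetaStep` (`contractCap_jwBoth_insertCup_insertCups`). The product of the scalars
telescopes to `θ_q / [k+1]_q`. Written with `q`-Pochhammer symbols it is `q^{-r}` times a ratio
bounded below by `C(q)⁻²`. -/

lemma qParam_pos {N : ℕ} (hN : 3 ≤ N) : 0 < qParam N := by
  have : (0 : ℝ) < N := by positivity
  unfold qParam
  positivity

/-- This is what ties `q` to the tensor calculus: a closed loop contributes `N = [2]_q`. -/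
lemma qParam_add_inv {N : ℕ} (hN : 3 ≤ N) : qParam N + (qParam N)⁻¹ = N := by
  have hN' : (3 : ℝ) ≤ N := by exact_mod_cast hN
  have h0 : (0 : ℝ) < N := by linarith
  have h1 : 0 ≤ 1 - 4 / (N : ℝ) ^ 2 := by
    rw [sub_nonneg, div_le_one (by positivity)]
    nlinarith
  have hs := Real.sq_sqrt h1
  have hs0 := Real.sqrt_nonneg (1 - 4 / (N : ℝ) ^ 2)
  unfold qParam
  generalize Real.sqrt (1 - 4 / (N : ℝ) ^ 2) = s at *
  have h2 : (N : ℝ) ^ 2 * s ^ 2 = N ^ 2 - 4 := by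
    rw [hs]
    field_simp
  field_simp
  nlinarith

lemma qParam_lt_one {N : ℕ} (hN : 3 ≤ N) : qParam N < 1 := by
  have hN' : (3 : ℝ) ≤ N := by exact_mod_cast hN
  unfold qParam
  have := Real.sqrt_nonneg (1 - 4 / (N : ℝ) ^ 2)
  rw [div_mul_div_comm, div_lt_one (by positivity)]
  nlinarith

lemma inv_sub_self_pos {q : ℝ} (h0 : 0 < q) (h1 : q < 1) : 0 < q⁻¹ - q := by
  have := (one_lt_inv₀ h0).2 h1
  linarith

lemma qInt_zero (q : ℝ) : qInt q 0 = 0 := by simp [qInt]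

lemma qInt_one {q : ℝ} (h0 : 0 < q) (h1 : q < 1) : qInt q 1 = 1 := by
  simp only [qInt, pow_one]
  exact div_self (inv_sub_self_pos h0 h1).ne'

lemma qInt_succ_pos {q : ℝ} (h0 : 0 < q) (h1 : q < 1) (x : ℕ) : 0 < qInt q (x + 1) := by
  refine div_pos ?_ (inv_sub_self_pos h0 h1)
  have h2 : 1 < q⁻¹ ^ (x + 1) := one_lt_pow₀ ((one_lt_inv₀ h0).2 h1) (by omega)
  have h3 : q ^ (x + 1) < 1 := pow_lt_one₀ h0.le h1 (by omega)
  linarith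

/-- Expand, using `q q⁻¹ = 1`. The case `a = 1` is the three-term recurrence, and the identities for
`thetaStep` and the Wenzl coefficients all follow from instances of this one. -/
lemma qInt_mul_sub_mul {q : ℝ} (h0 : 0 < q) (h1 : q < 1) (a b : ℕ) :
    qInt q (a + 1) * qInt q (b + 1) - qInt q a * qInt q b = qInt q (a + b + 1) := by
  have hd := (inv_sub_self_pos h0 h1).ne'
  have hq : q * q⁻¹ = 1 := mul_inv_cancel₀ h0.ne'
  unfold qInt
  generalize q⁻¹ = Q at *
  rw [div_mul_div_comm, div_mul_div_comm, ← sub_div, div_eq_div_iff (mul_ne_zero hd hd) hd]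
  have e : (Q ^ (a + 1) - q ^ (a + 1)) * (Q ^ (b + 1) - q ^ (b + 1)) -
      (Q ^ a - q ^ a) * (Q ^ b - q ^ b) = (Q ^ (a + b + 1) - q ^ (a + b + 1)) * (Q - q) := by
    simp only [pow_succ, pow_add]
    linear_combination (Q ^ a * Q ^ b + q ^ a * q ^ b - Q ^ a * q ^ b - q ^ a * Q ^ b) * hq
  rw [e, mul_assoc]

lemma qInt_two {q : ℝ} (h0 : 0 < q) (h1 : q < 1) : qInt q 2 = q + q⁻¹ := by
  have hd := (inv_sub_self_pos h0 h1).ne'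
  rw [qInt, div_eq_iff hd]
  ring

/-- The quotient `θ_q(k, l + 1, m + 1) / θ_q(k, l, m)` of consecutive values of the theta net with
`l = a + r`, `m = b + r` and `k = a + b`. -/
def thetaStep (q : ℝ) (a b r : ℕ) : ℝ :=
  qInt q (r + 1) * qInt q (a + b + r + 2) / (qInt q (a + r + 1) * qInt q (b + r + 1))

lemma thetaStep_zero {q : ℝ} (h0 : 0 < q) (h1 : q < 1) (a b : ℕ) :
    thetaStep q a b 0 = q + q⁻¹ - qInt q a / qInt q (a + 1) - qInt q b / qInt q (b + 1) := by
  have ha := (qInt_succ_pos h0 h1 a).ne'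
  have hb := (qInt_succ_pos h0 h1 b).ne'
  have e1 := qInt_mul_sub_mul h0 h1 (a + 1) b
  have e2 := qInt_mul_sub_mul h0 h1 1 a
  rw [show 1 + 1 = 2 from rfl, qInt_two h0 h1, qInt_one h0 h1] at e2
  rw [show 1 + a + 1 = a + 1 + 1 by ring] at e2
  rw [show a + 1 + b + 1 = a + b + 2 by ring] at e1
  simp only [thetaStep, add_zero, zero_add, qInt_one h0 h1]
  generalize q + q⁻¹ = c at *
  field_simp
  rw [← e1]
  linear_combination (-qInt q (b + 1)) * e2

/-- The right-hand side has the form produced by expanding two Wenzl recursions around a cup: a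
loop, two straightened strands, and a cross term that falls back to `r`. -/
lemma thetaStep_succ {q : ℝ} (h0 : 0 < q) (h1 : q < 1) (a b r : ℕ) :
    thetaStep q a b (r + 1) = q + q⁻¹ - qInt q (a + r + 1) / qInt q (a + r + 2) -
      qInt q (b + r + 1) / qInt q (b + r + 2) +
      qInt q (a + r + 1) / qInt q (a + r + 2) * (qInt q (b + r + 1) / qInt q (b + r + 2)) *
        thetaStep q a b r := by
  have ha := (qInt_succ_pos h0 h1 (a + r)).ne'
  have hb := (qInt_succ_pos h0 h1 (b + r)).ne'
  have ha' := (qInt_succ_pos h0 h1 (a + r + 1)).ne'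
  have hb' := (qInt_succ_pos h0 h1 (b + r + 1)).ne'
  have e1 := qInt_mul_sub_mul h0 h1 (a + r + 2) (b + r + 1)
  have e2 := qInt_mul_sub_mul h0 h1 1 (a + r + 1)
  have e3 := qInt_mul_sub_mul h0 h1 (r + 1) (a + b + r + 2)
  rw [show 1 + 1 = 2 from rfl, qInt_two h0 h1, qInt_one h0 h1] at e2
  rw [show 1 + (a + r + 1) + 1 = a + r + 2 + 1 by ring] at e2
  rw [show a + r + 2 + (b + r + 1) + 1 = r + 1 + (a + b + r + 2) + 1 by ring, ← e3] at e1
  simp only [thetaStep, show a + (r + 1) + 1 = a + r + 2 by ring, show r + 1 + 1 = r + 2 by ring,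
    show b + (r + 1) + 1 = b + r + 2 by ring, show a + b + (r + 1) + 2 = a + b + r + 3 by ring]
    at *
  generalize q + q⁻¹ = c at *
  field_simp
  linear_combination (-qInt q (b + r + 2)) * e2 - e1

lemma qFact_succ (q : ℝ) (x : ℕ) : qFact q (x + 1) = qFact q x * qInt q (x + 1) :=
  Finset.prod_range_succ _ _

lemma qFact_pos {q : ℝ} (h0 : 0 < q) (h1 : q < 1) (x : ℕ) : 0 < qFact q x :=
  Finset.prod_pos fun s _ => qInt_succ_pos h0 h1 s

lemma theta_div_eq_prod {q : ℝ} (h0 : 0 < q) (h1 : q < 1) (a b r : ℕ) :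
    theta q (a + b) (a + r) (b + r) r / qInt q (a + b + 1) =
      ∏ s ∈ Finset.range r, thetaStep q a b s := by
  have hf := fun x => (qFact_pos h0 h1 x).ne'
  have hi := fun x => (qInt_succ_pos h0 h1 x).ne'
  induction r with
  | zero =>
    simp only [theta, Nat.sub_zero, add_zero, qFact_succ, Finset.range_zero, Finset.prod_empty,
      show qFact q 0 = 1 from Finset.prod_range_zero _]
    have := hf a; have := hf b; have := hf (a + b); have := hi (a + b)
    field_simp
  | succ r ih =>
    rw [Finset.prod_range_succ, ← ih]
    simp only [theta, thetaStep, Nat.add_sub_cancel]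
    rw [show a + b + (r + 1) + 1 = (a + b + r + 1) + 1 by ring, show a + (r + 1) = a + r + 1 by ring,
      show b + (r + 1) = b + r + 1 by ring]
    simp only [qFact_succ]
    have := hf (a + r); have := hf (b + r); have := hf (a + b); have := hi (a + b)
    have := hi (a + r); have := hi (b + r)
    field_simp

/-! ### The lower bound on the theta net -/

/-- The `q`-Pochhammer symbol `(q², q²)_n`. -/
def qPoch (q : ℝ) (n : ℕ) : ℝ := ∏ s ∈ Finset.range n, (1 - q ^ (2 * (s + 1)))

lemma one_sub_pow_pos {q : ℝ} (h0 : 0 < q) (h1 : q < 1) (s : ℕ) : 0 < 1 - q ^ (2 * (s + 1)) :=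
  sub_pos.2 (pow_lt_one₀ h0.le h1 (by omega))

lemma qPoch_pos {q : ℝ} (h0 : 0 < q) (h1 : q < 1) (n : ℕ) : 0 < qPoch q n :=
  Finset.prod_pos fun s _ => one_sub_pow_pos h0 h1 s

lemma qPoch_antitone {q : ℝ} (h0 : 0 < q) (h1 : q < 1) : Antitone (qPoch q) := by
  refine antitone_nat_of_succ_le fun n => ?_
  rw [qPoch, Finset.prod_range_succ]
  refine mul_le_of_le_one_right (qPoch_pos h0 h1 n).le ?_
  have : 0 < q ^ (2 * (n + 1)) := by positivity
  linarith

/-- Substitute `[x]_q = q^{-x} (1 - q^{2x}) / (q⁻¹ - q)`; the exponents of `q` add up to `-1`, so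
each cup contributes one factor `q⁻¹`. -/
lemma thetaStep_eq {q : ℝ} (h0 : 0 < q) (h1 : q < 1) (a b r : ℕ) :
    thetaStep q a b r = q⁻¹ * ((1 - q ^ (2 * (r + 1))) * (1 - q ^ (2 * (a + b + r + 2))) /
      ((1 - q ^ (2 * (a + r + 1))) * (1 - q ^ (2 * (b + r + 1))))) := by
  have hd := (inv_sub_self_pos h0 h1).ne'
  have hq := h0.ne'
  have e : ∀ x, qInt q x = (1 - q ^ (2 * x)) / (q ^ x * (q⁻¹ - q)) := by
    intro x
    rw [qInt, div_eq_div_iff hd (mul_ne_zero (pow_ne_zero _ hq) hd)]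
    have : q⁻¹ ^ x * q ^ x = 1 := by rw [← mul_pow, inv_mul_cancel₀ hq, one_pow]
    rw [two_mul, pow_add]
    linear_combination (q⁻¹ - q) * this
  have ha := (one_sub_pow_pos h0 h1 (a + r)).ne'
  have hb := (one_sub_pow_pos h0 h1 (b + r)).ne'
  simp only [thetaStep, e]
  generalize q⁻¹ - q = D at *
  field_simp
  ring

lemma prod_thetaStep_eq {q : ℝ} (h0 : 0 < q) (h1 : q < 1) (a b r : ℕ) :
    ∏ s ∈ Finset.range r, thetaStep q a b s = q⁻¹ ^ r * (qPoch q r * qPoch q (a + b + r + 1) *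
      qPoch q a * qPoch q b / (qPoch q (a + r) * qPoch q (b + r) * qPoch q (a + b + 1))) := by
  have hp := fun x => (qPoch_pos h0 h1 x).ne'
  have hs : ∀ x, qPoch q (x + 1) = qPoch q x * (1 - q ^ (2 * (x + 1))) := fun x =>
    Finset.prod_range_succ _ _
  induction r with
  | zero =>
    have := hp a; have := hp b; have := hp (a + b + 1)
    simp only [Finset.range_zero, Finset.prod_empty, pow_zero, add_zero, one_mul,
      show qPoch q 0 = 1 from Finset.prod_range_zero _]
    field_simp
  | succ r ih =>
    rw [Finset.prod_range_succ, ih, thetaStep_eq h0 h1,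
      show a + b + (r + 1) + 1 = a + b + r + 1 + 1 by ring, show a + (r + 1) = a + r + 1 by ring,
      show b + (r + 1) = b + r + 1 by ring, hs r, hs (a + b + r + 1), hs (a + r), hs (b + r)]
    have := hp (a + r); have := hp (b + r); have := hp (a + b + 1)
    have := (one_sub_pow_pos h0 h1 (a + r)).ne'
    have := (one_sub_pow_pos h0 h1 (b + r)).ne'
    generalize q⁻¹ = Q
    field_simp
    ring

/-- All Pochhammer symbols lie between `D⁻¹` and 1, where `D` is the infinite product, and they
decrease in their index. Two symbols in the numerator cost `D⁻²`, and the remaining quotient is at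
least 1 by monotonicity. Since `C(q)⁻² = (1 - q²) D⁻³`, a factor `(1 - q²) D⁻¹ ≤ 1` is to spare. -/
lemma constC_bound {q : ℝ} (h0 : 0 < q) (h1 : q < 1) (a b r : ℕ) :
    (constC q)⁻¹ ^ 2 * q⁻¹ ^ r ≤ theta q (a + b) (a + r) (b + r) r / qInt q (a + b + 1) := by
  rw [theta_div_eq_prod h0 h1, prod_thetaStep_eq h0 h1, mul_comm]
  refine mul_le_mul_of_nonneg_left ?_ (by positivity)
  have hm := multipliable_constC h0.le h1
  set D : ℝ := ∏' s : ℕ, 1 / (1 - q ^ (2 * (s + 1))) with hD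
  have hfin : ∀ n, (qPoch q n)⁻¹ ≤ D := fun n => by
    have h2 : ∀ M, ∏ s ∈ Finset.range M, 1 / (1 - q ^ (2 * (s + 1))) = (qPoch q M)⁻¹ := by
      simp [qPoch]
    refine ge_of_tendsto hm.hasProd.tendsto_prod_nat
      (Filter.eventually_atTop.2 ⟨n, fun M hM => ?_⟩)
    rw [h2]
    exact inv_anti₀ (qPoch_pos h0 h1 M) (qPoch_antitone h0 h1 hM)
  have hD1 : 1 ≤ D := by simpa [qPoch] using hfin 0
  have hD0 : 0 < D := by linarith
  have hP : ∀ n, D⁻¹ ≤ qPoch q n := fun n => inv_le_of_inv_le₀ (qPoch_pos h0 h1 n) (hfin n)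
  have hq2 : 0 < 1 - q ^ 2 := by simpa using one_sub_pow_pos h0 h1 0
  have hC : (constC q)⁻¹ ^ 2 = (1 - q ^ 2) * D⁻¹ ^ 3 := by
    have e1 : ((1 - q ^ 2) ^ (-(1 / 2) : ℝ)) ^ 2 = (1 - q ^ 2)⁻¹ := by
      rw [← Real.rpow_natCast, ← Real.rpow_mul hq2.le]
      norm_num [Real.rpow_neg_one]
    have e2 : (D ^ (3 / 2 : ℝ)) ^ 2 = D ^ 3 := by
      rw [← Real.rpow_natCast, ← Real.rpow_mul hD0.le]
      norm_num
    rw [constC, ← hD, inv_pow, mul_pow, e1, e2, mul_inv, inv_inv, inv_pow]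
  rw [hC]
  have hp := qPoch_pos h0 h1
  have han := qPoch_antitone h0 h1
  have hle1 : ∀ n, qPoch q n ≤ 1 := fun n => by
    simpa [qPoch] using han (Nat.zero_le n)
  have hx : 0 < D⁻¹ := inv_pos.2 hD0
  have hx1 : D⁻¹ ≤ 1 := inv_le_one_of_one_le₀ hD1
  calc (1 - q ^ 2) * D⁻¹ ^ 3 ≤ 1 * D⁻¹ ^ 2 := by
        have : 0 < q ^ 2 := by positivity
        refine mul_le_mul (by linarith) (pow_le_pow_of_le_one hx.le hx1 (by norm_num))
          (by positivity) zero_le_one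
    _ = D⁻¹ * D⁻¹ := by ring
    _ ≤ qPoch q r * qPoch q (a + b + r + 1) := mul_le_mul (hP _) (hP _) hx.le (hp _).le
    _ ≤ _ := by
        rw [le_div_iff₀ (mul_pos (mul_pos (hp _) (hp _)) (hp _)), mul_assoc _ (qPoch q a)]
        refine mul_le_mul_of_nonneg_left ?_ (mul_pos (hp _) (hp _)).le
        have h3 := mul_le_mul (han (Nat.le_add_right a r)) (han (Nat.le_add_right b r))
          (hp _).le (hp _).le
        exact (mul_le_of_le_one_right (mul_pos (hp _) (hp _)).le (hle1 _)).trans h3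

/-! ### Words and operators on tensor powers -/

section Words

lemma exists_eq_cons {N k : ℕ} (x : Fin (k + 1) → Fin N) : ∃ i y, x = Fin.cons i y :=
  ⟨x 0, Fin.tail x, (Fin.cons_self_tail x).symm⟩

lemma exists_eq_snoc {N k : ℕ} (x : Fin (k + 1) → Fin N) : ∃ i y, x = Fin.snoc y i :=
  ⟨x (Fin.last k), Fin.init x, (Fin.snoc_init_self x).symm⟩

variable {N k : ℕ} {M : Type*} [AddCommMonoid M]

lemma sum_cons (f : (Fin (k + 1) → Fin N) → M) :
    ∑ x, f x = ∑ i : Fin N, ∑ y : Fin k → Fin N, f (Fin.cons i y) := by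
  rw [← (Fin.consEquiv fun _ => Fin N).sum_comp, Fintype.sum_prod_type]
  rfl

lemma sum_snoc (f : (Fin (k + 1) → Fin N) → M) :
    ∑ x, f x = ∑ i : Fin N, ∑ y : Fin k → Fin N, f (Fin.snoc y i) := by
  rw [← (Fin.snocEquiv fun _ => Fin N).sum_comp, Fintype.sum_prod_type]
  rfl

end Words

/-! ### Cups, caps and partial traces as matrices -/

section Matrices
variable {N k : ℕ}

open Matrix

/-- The map `T₁ ⊗ ι`. -/
def cupL (N k : ℕ) : Matrix (Fin (k + 2) → Fin N) (Fin k → Fin N) ℂ :=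
  fun x y => if Fin.tail x = Fin.cons (x 0) y then 1 else 0

/-- The left partial trace. -/
def ptraceL (A : Matrix (Fin (k + 1) → Fin N) (Fin (k + 1) → Fin N) ℂ) :
    Matrix (Fin k → Fin N) (Fin k → Fin N) ℂ :=
  fun x y => ∑ h, A (Fin.cons h x) (Fin.cons h y)

lemma idTensor_cons (A : Matrix (Fin k → Fin N) (Fin k → Fin N) ℂ) (i j : Fin N)
    (x y : Fin k → Fin N) :
    idTensor A (Fin.cons i x) (Fin.cons j y) = if i = j then A x y else 0 := by
  simp [idTensor]

lemma idTensor_mul_cons {o : Type*} (A : Matrix (Fin k → Fin N) (Fin k → Fin N) ℂ)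
    (B : Matrix (Fin (k + 1) → Fin N) o ℂ) (i : Fin N) (x : Fin k → Fin N) (z : o) :
    (idTensor A * B) (Fin.cons i x) z = ∑ y, A x y * B (Fin.cons i y) z := by
  rw [mul_apply, sum_cons, Finset.sum_eq_single i]
  · simp [idTensor_cons]
  · intro j _ hj
    simp [idTensor_cons, hj.symm]
  · simp

lemma idTensor_mul (A B : Matrix (Fin k → Fin N) (Fin k → Fin N) ℂ) :
    idTensor (A * B) = idTensor A * idTensor B := by
  ext x y
  obtain ⟨i, x, rfl⟩ := exists_eq_cons x
  obtain ⟨j, y, rfl⟩ := exists_eq_cons y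
  rw [idTensor_mul_cons]
  by_cases h : i = j <;> simp [idTensor_cons, h, mul_apply]

lemma idTensor_one : idTensor (1 : Matrix (Fin k → Fin N) (Fin k → Fin N) ℂ) = 1 := by
  ext x y
  obtain ⟨i, x, rfl⟩ := exists_eq_cons x
  obtain ⟨j, y, rfl⟩ := exists_eq_cons y
  by_cases h : i = j <;> simp [idTensor_cons, h, one_apply]

lemma idTensor_transpose (A : Matrix (Fin k → Fin N) (Fin k → Fin N) ℂ) :
    (idTensor A)ᵀ = idTensor Aᵀ := by
  ext x y
  simp [idTensor, eq_comm]

lemma idTensor_map_star (A : Matrix (Fin k → Fin N) (Fin k → Fin N) ℂ) :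
    (idTensor A).map star = idTensor (A.map star) := by
  ext x y
  simp only [idTensor, map_apply]
  split_ifs <;> simp

lemma cupL_cons (i : Fin N) (x : Fin (k + 1) → Fin N) (y : Fin k → Fin N) :
    cupL N k (Fin.cons i x) y = if x = Fin.cons i y then 1 else 0 := by
  simp [cupL]

lemma idTensor_mul_cupL_cons (A : Matrix (Fin (k + 1) → Fin N) (Fin (k + 1) → Fin N) ℂ) (i : Fin N)
    (x : Fin (k + 1) → Fin N) (y : Fin k → Fin N) :
    (idTensor A * cupL N k) (Fin.cons i x) y = A x (Fin.cons i y) := by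
  simp [idTensor_mul_cons, cupL_cons]

lemma cupL_transpose_mulVec (v : (Fin (k + 2) → Fin N) → ℂ) (y : Fin k → Fin N) :
    ((cupL N k)ᵀ *ᵥ v) y = ∑ i, v (Fin.cons i (Fin.cons i y)) := by
  simp [mulVec, dotProduct, sum_cons (k := k + 1), cupL_cons]

lemma cupL_transpose_mul {o : Type*} (B : Matrix (Fin (k + 2) → Fin N) o ℂ) (y : Fin k → Fin N)
    (z : o) : ((cupL N k)ᵀ * B) y z = ∑ i, B (Fin.cons i (Fin.cons i y)) z :=
  cupL_transpose_mulVec (fun x => B x z) y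

lemma cupCap_eq : cupCap N k = cupL N k * (cupL N k)ᵀ := by
  ext x y
  obtain ⟨i, x, rfl⟩ := exists_eq_cons x
  obtain ⟨i', x, rfl⟩ := exists_eq_cons x
  obtain ⟨j, y, rfl⟩ := exists_eq_cons y
  obtain ⟨j', y, rfl⟩ := exists_eq_cons y
  have e : ∀ (i i' : Fin N) (x z : Fin k → Fin N),
      cupL N k (Fin.cons i (Fin.cons i' x)) z = if z = x then (if i = i' then 1 else 0) else 0 := by
    intro i i' x z
    rw [cupL_cons, ← ite_and]
    refine if_congr ?_ rfl rfl
    rw [Fin.cons_inj]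
    exact ⟨fun h => ⟨h.2.symm, h.1.symm⟩, fun h => ⟨h.2.symm, h.1.symm⟩⟩
  have h1 : ∀ (a b : Fin N) (u : Fin k → Fin N),
    (Fin.cons a (Fin.cons b u) : Fin (k + 2) → Fin N) 1 = b := fun _ _ _ => rfl
  simp only [mul_apply, transpose_apply, e, cupCap, Fin.cons_zero, h1, Fin.tail_cons]
  by_cases hi : i = i' <;> by_cases hj : j = j' <;> simp [hi, hj, eq_comm]

lemma cupL_transpose_mul_idTensor_mul_cupL
    (A : Matrix (Fin (k + 1) → Fin N) (Fin (k + 1) → Fin N) ℂ) :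
    (cupL N k)ᵀ * idTensor A * cupL N k = ptraceL A := by
  ext x y
  rw [Matrix.mul_assoc, cupL_transpose_mul]
  simp only [idTensor_mul_cupL_cons, ptraceL]

lemma idTensor_idTensor_mul_cupL (B : Matrix (Fin k → Fin N) (Fin k → Fin N) ℂ) :
    idTensor (idTensor B) * cupL N k = cupL N k * B := by
  ext x y
  obtain ⟨i, x, rfl⟩ := exists_eq_cons x
  obtain ⟨i', x, rfl⟩ := exists_eq_cons x
  rw [idTensor_mul_cupL_cons, idTensor_cons, mul_apply]
  simp only [cupL_cons, Fin.cons_inj]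
  by_cases h : i' = i <;> simp [h]

lemma cupL_transpose_mul_idTensor_idTensor (B : Matrix (Fin k → Fin N) (Fin k → Fin N) ℂ) :
    (cupL N k)ᵀ * idTensor (idTensor B) = B * (cupL N k)ᵀ := by
  have := congrArg transpose (idTensor_idTensor_mul_cupL (Bᵀ))
  rwa [transpose_mul, transpose_mul, idTensor_transpose, idTensor_transpose,
    transpose_transpose] at this

lemma ptraceL_idTensor (A : Matrix (Fin k → Fin N) (Fin k → Fin N) ℂ) :
    ptraceL (idTensor A) = (N : ℂ) • A := by
  ext x y
  simp [ptraceL, idTensor_cons]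

/-- The first leg passes through `ι ⊗ A` untouched, so closing it joins the cup to the cap and
leaves a plain strand between the two copies of `A`. -/
lemma ptraceL_idTensor_cupCap_idTensor
    (A : Matrix (Fin (k + 1) → Fin N) (Fin (k + 1) → Fin N) ℂ) :
    ptraceL (idTensor A * cupCap N k * idTensor A) = A * A := by
  ext x y
  have e : idTensor A * cupCap N k * idTensor A =
      (idTensor A * cupL N k) * (idTensor Aᵀ * cupL N k)ᵀ := by
    rw [cupCap_eq, transpose_mul, idTensor_transpose, transpose_transpose]
    simp only [Matrix.mul_assoc]
  rw [e, ptraceL, mul_apply, sum_cons]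
  simp only [mul_apply (M := idTensor A * cupL N k), transpose_apply, idTensor_mul_cupL_cons]

/-! ### Jones-Wenzl projections -/

/-- The coefficient `[k]_q / [k + 1]_q` of the Wenzl recursion. -/
def wenzlCoeff (N k : ℕ) : ℝ := qInt (qParam N) k / qInt (qParam N) (k + 1)

lemma wenzlCoeff_succ_pos (hN : 3 ≤ N) (k : ℕ) : 0 < wenzlCoeff N (k + 1) :=
  div_pos (qInt_succ_pos (qParam_pos hN) (qParam_lt_one hN) _)
    (qInt_succ_pos (qParam_pos hN) (qParam_lt_one hN) _)

lemma sub_wenzlCoeff (hN : 3 ≤ N) (k : ℕ) :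
    (N : ℝ) - wenzlCoeff N k = (wenzlCoeff N (k + 1))⁻¹ := by
  have h0 := qParam_pos hN
  have h1 := qParam_lt_one hN
  have e := qInt_mul_sub_mul h0 h1 1 k
  have h2 := (qInt_succ_pos h0 h1 k).ne'
  rw [show 1 + 1 = 2 from rfl, qInt_two h0 h1, qInt_one h0 h1, qParam_add_inv hN,
    show 1 + k + 1 = k + 1 + 1 by ring] at e
  rw [wenzlCoeff, wenzlCoeff, inv_div]
  field_simp
  linarith

lemma jonesWenzl_zero : jonesWenzl N 0 = 1 := rfl

lemma jonesWenzl_one : jonesWenzl N 1 = 1 := rfl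

lemma jonesWenzl_succ_succ (k : ℕ) : jonesWenzl N (k + 2) = idTensor (jonesWenzl N (k + 1)) -
    (wenzlCoeff N (k + 1) : ℂ) •
      (idTensor (jonesWenzl N (k + 1)) * cupCap N k * idTensor (jonesWenzl N (k + 1))) := rfl

lemma jonesWenzl_transpose (k : ℕ) : (jonesWenzl N k)ᵀ = jonesWenzl N k := by
  induction k using Nat.twoStepInduction with
  | zero => simp [jonesWenzl_zero]
  | one => simp [jonesWenzl_one]
  | more k _ ih =>
    rw [jonesWenzl_succ_succ, cupCap_eq]
    simp only [transpose_sub, transpose_smul, transpose_mul, idTensor_transpose, ih,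
      transpose_transpose, Matrix.mul_assoc]

lemma jonesWenzl_map_star (k : ℕ) : (jonesWenzl N k).map star = jonesWenzl N k := by
  induction k using Nat.twoStepInduction with
  | zero => ext x y; simp [jonesWenzl_zero, one_apply, apply_ite]
  | one => ext x y; simp [jonesWenzl_one, one_apply, apply_ite]
  | more k _ ih =>
    have h := idTensor_map_star (jonesWenzl N (k + 1))
    rw [ih] at h
    have hE : (cupCap N k).map star = cupCap N k := by
      ext x y; simp only [cupCap, map_apply]; split_ifs <;> simp
    have hm : ∀ A B : Matrix (Fin (k + 2) → Fin N) (Fin (k + 2) → Fin N) ℂ,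
        (A * B).map star = A.map star * B.map star := fun A B =>
      Matrix.map_mul (f := starRingEnd ℂ)
    rw [jonesWenzl_succ_succ]
    have : ∀ (c : ℝ) (A B : Matrix (Fin (k + 2) → Fin N) (Fin (k + 2) → Fin N) ℂ),
        (A - (c : ℂ) • B).map star = A.map star - (c : ℂ) • B.map star := by
      intro c A B; ext x y; simp
    rw [this, hm, hm, h, hE]

/-- The claims need each other, hence the joint induction. The partial trace of `p_{k+1}` is `T₁^*
(ι ⊗ p_{k+1}) T₁`, so knowing it to be `c⁻¹ p_k` makes the correction term of the recursion,
including its coefficient `c`, an idempotent below `ι ⊗ p_{k+1}`. The next partial trace then has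
scalar `N - c`, which `sub_wenzlCoeff` identifies with the next inverse coefficient. -/
lemma jonesWenzl_aux (hN : 3 ≤ N) (k : ℕ) :
    (jonesWenzl N k * jonesWenzl N k = jonesWenzl N k ∧
      jonesWenzl N (k + 1) * jonesWenzl N (k + 1) = jonesWenzl N (k + 1)) ∧
      idTensor (jonesWenzl N k) * jonesWenzl N (k + 1) = jonesWenzl N (k + 1) ∧
      ptraceL (jonesWenzl N (k + 1)) = ((wenzlCoeff N (k + 1))⁻¹ : ℂ) • jonesWenzl N k := by
  induction k with
  | zero =>
    refine ⟨⟨by simp [jonesWenzl_zero], by simp [jonesWenzl_one]⟩, ?_, ?_⟩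
    · simp [jonesWenzl_zero, jonesWenzl_one, idTensor_one]
    · rw [jonesWenzl_one, ← idTensor_one, ptraceL_idTensor, jonesWenzl_zero]
      have := sub_wenzlCoeff hN 0
      rw [wenzlCoeff, qInt_zero, zero_div, sub_zero] at this
      rw [← Complex.ofReal_inv, ← this, Complex.ofReal_natCast]
  | succ k ih =>
    obtain ⟨⟨-, hp⟩, hQ, htr⟩ := ih
    have hc : (wenzlCoeff N (k + 1) : ℂ) ≠ 0 := by
      exact_mod_cast (wenzlCoeff_succ_pos hN k).ne'
    have hPP : idTensor (jonesWenzl N (k + 1)) * idTensor (jonesWenzl N (k + 1)) =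
        idTensor (jonesWenzl N (k + 1)) := by rw [← idTensor_mul, hp]
    have hQP : idTensor (idTensor (jonesWenzl N k)) * idTensor (jonesWenzl N (k + 1)) =
        idTensor (jonesWenzl N (k + 1)) := by rw [← idTensor_mul, hQ]
    have hTPT := cupL_transpose_mul_idTensor_mul_cupL (jonesWenzl N (k + 1))
    have hTQ := cupL_transpose_mul_idTensor_idTensor (jonesWenzl N k)
    rw [htr] at hTPT
    have hPEP : (cupL N k)ᵀ * idTensor (jonesWenzl N (k + 1)) * (cupL N k * ((cupL N k)ᵀ *
        idTensor (jonesWenzl N (k + 1)))) = (wenzlCoeff N (k + 1) : ℂ)⁻¹ • ((cupL N k)ᵀ *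
          idTensor (jonesWenzl N (k + 1))) := by
      rw [← Matrix.mul_assoc, hTPT, Matrix.smul_mul, ← Matrix.mul_assoc, ← hTQ, Matrix.mul_assoc,
        hQP]
    refine ⟨⟨hp, ?_⟩, ?_, ?_⟩
    · rw [jonesWenzl_succ_succ, cupCap_eq]
      generalize idTensor (jonesWenzl N (k + 1)) = P at *
      generalize (wenzlCoeff N (k + 1) : ℂ) = c at *
      have e : P * (cupL N k * (cupL N k)ᵀ) * P * (P * (cupL N k * (cupL N k)ᵀ) * P) =
          c⁻¹ • (P * (cupL N k * (cupL N k)ᵀ) * P) := by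
        calc _ = P * cupL N k * ((cupL N k)ᵀ * (P * P) * (cupL N k * ((cupL N k)ᵀ * P))) := by
              simp only [Matrix.mul_assoc]
          _ = _ := by
              rw [hPP, hPEP]
              simp only [Matrix.mul_assoc, Matrix.mul_smul]
      have e1 : P * (P * (cupL N k * (cupL N k)ᵀ) * P) = P * (cupL N k * (cupL N k)ᵀ) * P := by
        rw [← Matrix.mul_assoc, ← Matrix.mul_assoc, hPP]
      have e2 : P * (cupL N k * (cupL N k)ᵀ) * P * P = P * (cupL N k * (cupL N k)ᵀ) * P := by
        rw [Matrix.mul_assoc _ P P, hPP]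
      rw [Matrix.sub_mul, Matrix.mul_sub, Matrix.mul_sub, Matrix.mul_smul, Matrix.smul_mul,
        Matrix.smul_mul, Matrix.mul_smul, e, e1, e2, hPP, smul_smul c c⁻¹, mul_inv_cancel₀ hc,
        one_smul, sub_self, sub_zero]
    · rw [jonesWenzl_succ_succ, Matrix.mul_sub, Matrix.mul_smul, Matrix.mul_assoc _ (cupCap N k),
        ← Matrix.mul_assoc _ _ (cupCap N k * _), hPP]
    · have hlin : ∀ (A B : Matrix (Fin (k + 2) → Fin N) (Fin (k + 2) → Fin N) ℂ) (c : ℂ),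
          ptraceL (A - c • B) = ptraceL A - c • ptraceL B := by
        intro A B c
        ext x y
        simp [ptraceL, Finset.mul_sum]
      rw [jonesWenzl_succ_succ, hlin, ptraceL_idTensor, ptraceL_idTensor_cupCap_idTensor, hp,
        ← sub_smul, ← Complex.ofReal_inv, ← sub_wenzlCoeff hN]
      simp

lemma jonesWenzl_mul_self (hN : 3 ≤ N) (k : ℕ) : jonesWenzl N k * jonesWenzl N k = jonesWenzl N k :=
  (jonesWenzl_aux hN k).1.1

lemma idTensor_mul_jonesWenzl (hN : 3 ≤ N) (k : ℕ) :
    idTensor (jonesWenzl N k) * jonesWenzl N (k + 1) = jonesWenzl N (k + 1) :=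
  (jonesWenzl_aux hN k).2.1

lemma jonesWenzl_mul_idTensor (hN : 3 ≤ N) (k : ℕ) :
    jonesWenzl N (k + 1) * idTensor (jonesWenzl N k) = jonesWenzl N (k + 1) := by
  have := congrArg transpose (idTensor_mul_jonesWenzl hN k)
  rwa [transpose_mul, idTensor_transpose, jonesWenzl_transpose, jonesWenzl_transpose] at this

/-- The Wenzl coefficient is exactly the inverse of the partial-trace scalar, so the correction term
cancels `T₁^* (ι ⊗ p_{k+1})` once `p_k` has been moved through `T₁^*` and absorbed. -/
lemma cupL_transpose_mul_jonesWenzl (hN : 3 ≤ N) (k : ℕ) :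
    (cupL N k)ᵀ * jonesWenzl N (k + 2) = 0 := by
  have hc : (wenzlCoeff N (k + 1) : ℂ) ≠ 0 := by
    exact_mod_cast (wenzlCoeff_succ_pos hN k).ne'
  have hTPT := cupL_transpose_mul_idTensor_mul_cupL (jonesWenzl N (k + 1))
  rw [(jonesWenzl_aux hN k).2.2] at hTPT
  rw [jonesWenzl_succ_succ, cupCap_eq, Matrix.mul_sub, Matrix.mul_smul]
  have : (cupL N k)ᵀ * (idTensor (jonesWenzl N (k + 1)) * (cupL N k * (cupL N k)ᵀ) *
      idTensor (jonesWenzl N (k + 1))) = (cupL N k)ᵀ * idTensor (jonesWenzl N (k + 1)) *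
        cupL N k * (cupL N k)ᵀ * idTensor (jonesWenzl N (k + 1)) := by
    simp only [Matrix.mul_assoc]
  rw [this, hTPT, Matrix.smul_mul, Matrix.smul_mul, smul_smul, mul_inv_cancel₀ hc, one_smul,
    ← cupL_transpose_mul_idTensor_idTensor, Matrix.mul_assoc, ← idTensor_mul,
    idTensor_mul_jonesWenzl hN, sub_self]

/-! ### The range of the Jones-Wenzl projections -/

/-- A tensor is cap-free if all contractions of adjacent legs vanish. -/
def CapFree (v : (Fin k → Fin N) → ℂ) : Prop :=
  ∀ (i j : Fin k), (i : ℕ) + 1 = j → ∀ x : Fin k → Fin N,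
    ∑ h, v (Function.update (Function.update x i h) j h) = 0

/-- Separates the cap on the first two legs from the others, to match the left-handed Wenzl
recursion. -/
lemma capFree_succ_succ_iff (v : (Fin (k + 2) → Fin N) → ℂ) :
    CapFree v ↔ (∀ y : Fin k → Fin N, ∑ h, v (Fin.cons h (Fin.cons h y)) = 0) ∧
      ∀ a, CapFree fun y : Fin (k + 1) → Fin N => v (Fin.cons a y) := by
  have e0 : ∀ (x : Fin (k + 2) → Fin N) (h : Fin N),
      Function.update (Function.update x 0 h) 1 h = Fin.cons h (Fin.cons h (Fin.tail (Fin.tail x))) := by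
    intro x h
    funext j
    refine Fin.cases ?_ (fun j => Fin.cases ?_ (fun j => ?_) j) j
    · simp [Function.update]
    · simp [Function.update]
    · have h1 : j.succ.succ ≠ 1 := by simp [Fin.ext_iff]
      have h0 : j.succ.succ ≠ 0 := by simp [Fin.ext_iff]
      rw [Function.update_of_ne h1, Function.update_of_ne h0]
      rfl
  constructor
  · intro hv
    refine ⟨fun y => ?_, fun a i j hij x => ?_⟩
    · rcases Nat.eq_zero_or_pos N with rfl | hN
      · simp
      · have := hv 0 1 rfl (Fin.cons ⟨0, hN⟩ (Fin.cons ⟨0, hN⟩ y))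
        simpa only [e0, Fin.tail_cons] using this
    · have := hv i.succ j.succ (by simp [hij]) (Fin.cons a x)
      simpa only [Fin.cons_update] using this
  · rintro ⟨h1, h2⟩ i j hij x
    induction i using Fin.cases with
    | zero =>
      obtain rfl : j = 1 := Fin.ext (by simpa using hij.symm)
      simpa only [e0] using h1 _
    | succ i =>
      induction j using Fin.cases with
      | zero => simp at hij
      | succ j =>
        have := h2 (x 0) i j (by simpa using hij) (Fin.tail x)
        simpa only [Fin.cons_update, Fin.cons_self_tail] using this

lemma idTensor_mulVec_cons (A : Matrix (Fin k → Fin N) (Fin k → Fin N) ℂ)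
    (v : (Fin (k + 1) → Fin N) → ℂ) (i : Fin N) (x : Fin k → Fin N) :
    (idTensor A *ᵥ v) (Fin.cons i x) = (A *ᵥ fun y => v (Fin.cons i y)) x := by
  have := idTensor_mul_cons A (replicateCol Unit v) i x ()
  simpa [mul_apply, mulVec, dotProduct] using this

lemma capFree_of_le_one (hk : k ≤ 1) (v : (Fin k → Fin N) → ℂ) : CapFree v := by
  intro i j hij
  omega

lemma capFree_jonesWenzl_mulVec (hN : 3 ≤ N) (v : (Fin k → Fin N) → ℂ) :
    CapFree (jonesWenzl N k *ᵥ v) := by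
  induction k using Nat.twoStepInduction with
  | zero => exact capFree_of_le_one (by simp) _
  | one => exact capFree_of_le_one le_rfl _
  | more k _ ih =>
    rw [capFree_succ_succ_iff]
    refine ⟨fun y => ?_, fun a => ?_⟩
    · rw [← cupL_transpose_mulVec, mulVec_mulVec, cupL_transpose_mul_jonesWenzl hN, zero_mulVec,
        Pi.zero_apply]
    · rw [← idTensor_mul_jonesWenzl hN, ← mulVec_mulVec]
      simp only [idTensor_mulVec_cons]
      exact ih _

/-- With `capFree_jonesWenzl_mulVec` this identifies `H_k` with the cap-free tensors, a description
symmetric in left and right. In the recursion, the slices of `v` are fixed by induction and the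
correction term is killed by the first cap. -/
lemma CapFree.jonesWenzl_mulVec {v : (Fin k → Fin N) → ℂ} (hv : CapFree v) :
    jonesWenzl N k *ᵥ v = v := by
  induction k using Nat.twoStepInduction with
  | zero => simp [jonesWenzl_zero]
  | one => simp [jonesWenzl_one]
  | more k _ ih =>
    rw [capFree_succ_succ_iff] at hv
    have h1 : idTensor (jonesWenzl N (k + 1)) *ᵥ v = v := by
      funext x
      obtain ⟨i, x, rfl⟩ := exists_eq_cons x
      rw [idTensor_mulVec_cons, ih (hv.2 i)]
    have h2 : (cupL N k)ᵀ *ᵥ v = 0 := by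
      funext y
      rw [cupL_transpose_mulVec, hv.1 y, Pi.zero_apply]
    rw [jonesWenzl_succ_succ, cupCap_eq, sub_mulVec, smul_mulVec, ← mulVec_mulVec, h1,
      ← mulVec_mulVec, ← mulVec_mulVec, h2, mulVec_zero, mulVec_zero, smul_zero, sub_zero]

lemma CapFree.comp_rev {v : (Fin k → Fin N) → ℂ} (hv : CapFree v) :
    CapFree fun x => v (x ∘ Fin.rev) := by
  intro i j hij x
  rw [← hv j.rev i.rev (by simp only [Fin.val_rev]; omega) (x ∘ Fin.rev)]
  refine Finset.sum_congr rfl fun h _ => congrArg v ?_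
  have hne : i ≠ j := by rintro rfl; omega
  rw [Function.update_comm hne]
  have e : ∀ (i : Fin k) (u : Fin k → Fin N),
      Function.update u i h ∘ Fin.rev = Function.update (u ∘ Fin.rev) i.rev h := by
    intro i u
    exact Function.update_comp_equiv u Fin.revPerm i h
  rw [e, e]

/-! ### Reversal and the right-handed Wenzl recursion -/

/-- Reversal of words. -/
def revWord (N k : ℕ) : (Fin k → Fin N) ≃ (Fin k → Fin N) :=
  Fin.revPerm.arrowCongr (Equiv.refl _)

lemma revWord_apply (x : Fin k → Fin N) : revWord N k x = x ∘ Fin.rev := rfl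

lemma revWord_revWord (x : Fin k → Fin N) : revWord N k (revWord N k x) = x := by
  funext i
  simp [revWord_apply]

/-- Cap-freeness is invariant under reversal, so `p` fixes the columns of its reversal `p'`, that
is, `p p' = p'`. Transposing gives `p' p = p'` and reversing gives `p' p = p`. -/
lemma jonesWenzl_submatrix_revWord (hN : 3 ≤ N) (k : ℕ) :
    (jonesWenzl N k).submatrix (revWord N k) (revWord N k) = jonesWenzl N k := by
  set R := revWord N k
  set p := jonesWenzl N k with hp
  have key : p * p.submatrix R R = p.submatrix R R := by
    ext x y
    have h1 : CapFree fun z => p z (R y) := by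
      have := capFree_jonesWenzl_mulVec hN (Pi.single (R y) (1 : ℂ))
      rw [← hp, mulVec_single_one] at this
      exact this
    exact congrFun h1.comp_rev.jonesWenzl_mulVec x
  have h2 : p.submatrix R R * p = p.submatrix R R := by
    have := congrArg transpose key
    rwa [transpose_mul, transpose_submatrix, hp, jonesWenzl_transpose] at this
  have h3 : p.submatrix R R * p = p := by
    have := congrArg (fun A => A.submatrix R R) key
    simp only [← submatrix_mul_equiv p _ R R R, submatrix_submatrix] at this
    have hRR : R ∘ R = id := funext revWord_revWord
    simpa [hRR] using this
  rw [← h2, h3]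

/-- The matrix of `A ⊗ ι`. -/
def tensorId (A : Matrix (Fin k → Fin N) (Fin k → Fin N) ℂ) :
    Matrix (Fin (k + 1) → Fin N) (Fin (k + 1) → Fin N) ℂ :=
  fun x y => if x (Fin.last k) = y (Fin.last k) then A (Fin.init x) (Fin.init y) else 0

/-- The matrix of `ι ⊗ T₁ T₁^*`. -/
def cupCapR (N k : ℕ) : Matrix (Fin (k + 2) → Fin N) (Fin (k + 2) → Fin N) ℂ :=
  (cupCap N k).submatrix (revWord N (k + 2)) (revWord N (k + 2))

lemma tail_revWord (x : Fin (k + 1) → Fin N) :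
    Fin.tail (revWord N (k + 1) x) = revWord N k (Fin.init x) := by
  funext i
  simp [revWord_apply, Fin.tail, Fin.init, Fin.rev_succ]

lemma idTensor_submatrix_revWord (A : Matrix (Fin k → Fin N) (Fin k → Fin N) ℂ) :
    (idTensor A).submatrix (revWord N (k + 1)) (revWord N (k + 1)) =
      tensorId (A.submatrix (revWord N k) (revWord N k)) := by
  ext x y
  simp only [submatrix_apply, idTensor, tensorId, tail_revWord]
  simp [revWord_apply]

lemma jonesWenzl_succ_succ_right (hN : 3 ≤ N) (k : ℕ) :
    jonesWenzl N (k + 2) = tensorId (jonesWenzl N (k + 1)) - (wenzlCoeff N (k + 1) : ℂ) •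
      (tensorId (jonesWenzl N (k + 1)) * cupCapR N k * tensorId (jonesWenzl N (k + 1))) := by
  rw [← jonesWenzl_submatrix_revWord hN (k + 2), jonesWenzl_succ_succ, submatrix_sub,
    Pi.sub_apply, Pi.sub_apply, submatrix_smul, Pi.smul_apply, Pi.smul_apply]
  rw [← submatrix_mul_equiv _ _ _ (revWord N (k + 2)) _,
    ← submatrix_mul_equiv _ _ _ (revWord N (k + 2)) _, idTensor_submatrix_revWord,
    jonesWenzl_submatrix_revWord hN]
  rfl

lemma jonesWenzl_mul_tensorId (hN : 3 ≤ N) (k : ℕ) :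
    jonesWenzl N (k + 1) * tensorId (jonesWenzl N k) = jonesWenzl N (k + 1) := by
  have := congrArg (fun A => A.submatrix (revWord N (k + 1)) (revWord N (k + 1)))
    (jonesWenzl_mul_idTensor hN k)
  simp only [← submatrix_mul_equiv _ _ _ (revWord N (k + 1)) _, idTensor_submatrix_revWord,
    jonesWenzl_submatrix_revWord hN] at this
  exact this

end Matrices

/-! ### Insertion of `T₁` between two tensor factors -/

section Insertion
open Matrix

variable {N l m : ℕ}

/-- The map `ι ⊗ T₁ ⊗ ι : (ℂ^N)^{⊗ l} ⊗ (ℂ^N)^{⊗ m} → (ℂ^N)^{⊗ (l + 1)} ⊗ (ℂ^N)^{⊗ (m + 1)}`, where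
elements of tensor products are written as matrices. -/
def insertCup (X : Matrix (Fin l → Fin N) (Fin m → Fin N) ℂ) :
    Matrix (Fin (l + 1) → Fin N) (Fin (m + 1) → Fin N) ℂ :=
  fun x y => if x (Fin.last l) = y 0 then X (Fin.init x) (Fin.tail y) else 0

/-- The adjoint `ι ⊗ T₁^* ⊗ ι` of `insertCup`. -/
def contractCap (Y : Matrix (Fin (l + 1) → Fin N) (Fin (m + 1) → Fin N) ℂ) :
    Matrix (Fin l → Fin N) (Fin m → Fin N) ℂ :=
  fun x y => ∑ h, Y (Fin.snoc x h) (Fin.cons h y)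

lemma insertCup_snoc_cons (X : Matrix (Fin l → Fin N) (Fin m → Fin N) ℂ) (x : Fin l → Fin N)
    (y : Fin m → Fin N) (i j : Fin N) :
    insertCup X (Fin.snoc x i) (Fin.cons j y) = if i = j then X x y else 0 := by
  simp [insertCup]

lemma insertCup_smul (c : ℂ) (X : Matrix (Fin l → Fin N) (Fin m → Fin N) ℂ) :
    insertCup (c • X) = c • insertCup X := by
  ext x y
  simp [insertCup]

lemma insertCup_zero : insertCup (0 : Matrix (Fin l → Fin N) (Fin m → Fin N) ℂ) = 0 := by
  ext x y
  simp [insertCup]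

lemma contractCap_sub (Y Z : Matrix (Fin (l + 1) → Fin N) (Fin (m + 1) → Fin N) ℂ) :
    contractCap (Y - Z) = contractCap Y - contractCap Z := by
  ext x y
  simp [contractCap]

lemma contractCap_smul (c : ℂ) (Y : Matrix (Fin (l + 1) → Fin N) (Fin (m + 1) → Fin N) ℂ) :
    contractCap (c • Y) = c • contractCap Y := by
  ext x y
  simp [contractCap, Finset.mul_sum]

lemma tensorId_snoc (A : Matrix (Fin l → Fin N) (Fin l → Fin N) ℂ) (i j : Fin N)
    (x y : Fin l → Fin N) :
    tensorId A (Fin.snoc x i) (Fin.snoc y j) = if i = j then A x y else 0 := by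
  simp [tensorId]

lemma tensorId_mul_snoc {o : Type*} (A : Matrix (Fin l → Fin N) (Fin l → Fin N) ℂ)
    (B : Matrix (Fin (l + 1) → Fin N) o ℂ) (i : Fin N) (x : Fin l → Fin N) (z : o) :
    (tensorId A * B) (Fin.snoc x i) z = ∑ y, A x y * B (Fin.snoc y i) z := by
  rw [mul_apply, sum_snoc, Finset.sum_eq_single i]
  · simp [tensorId_snoc]
  · intro j _ hj
    simp [tensorId_snoc, hj.symm]
  · simp

lemma mul_idTensor_cons {o : Type*} (A : Matrix (Fin m → Fin N) (Fin m → Fin N) ℂ)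
    (B : Matrix o (Fin (m + 1) → Fin N) ℂ) (i : Fin N) (z : o) (y : Fin m → Fin N) :
    (B * idTensor A) z (Fin.cons i y) = ∑ u, B z (Fin.cons i u) * A u y := by
  rw [mul_apply, sum_cons, Finset.sum_eq_single i]
  · simp [idTensor_cons]
  · intro j _ hj
    simp [idTensor_cons, hj]
  · simp

lemma tensorId_mul_insertCup (A : Matrix (Fin l → Fin N) (Fin l → Fin N) ℂ)
    (X : Matrix (Fin l → Fin N) (Fin m → Fin N) ℂ) :
    tensorId A * insertCup X = insertCup (A * X) := by
  ext x y
  obtain ⟨i, x, rfl⟩ := exists_eq_snoc x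
  obtain ⟨j, y, rfl⟩ := exists_eq_cons y
  rw [tensorId_mul_snoc, insertCup_snoc_cons]
  by_cases h : i = j <;> simp [insertCup_snoc_cons, h, mul_apply]

lemma insertCup_mul_idTensor (A : Matrix (Fin m → Fin N) (Fin m → Fin N) ℂ)
    (X : Matrix (Fin l → Fin N) (Fin m → Fin N) ℂ) :
    insertCup X * idTensor A = insertCup (X * A) := by
  ext x y
  obtain ⟨i, x, rfl⟩ := exists_eq_snoc x
  obtain ⟨j, y, rfl⟩ := exists_eq_cons y
  rw [mul_idTensor_cons, insertCup_snoc_cons]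
  by_cases h : i = j <;> simp [insertCup_snoc_cons, h, mul_apply]

lemma contractCap_tensorId_mul (A : Matrix (Fin l → Fin N) (Fin l → Fin N) ℂ)
    (Y : Matrix (Fin (l + 1) → Fin N) (Fin (m + 1) → Fin N) ℂ) :
    contractCap (tensorId A * Y) = A * contractCap Y := by
  ext x y
  simp only [contractCap, tensorId_mul_snoc]
  simp only [mul_apply, contractCap, Finset.mul_sum]
  exact Finset.sum_comm

lemma contractCap_mul_idTensor (A : Matrix (Fin m → Fin N) (Fin m → Fin N) ℂ)
    (Y : Matrix (Fin (l + 1) → Fin N) (Fin (m + 1) → Fin N) ℂ) :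
    contractCap (Y * idTensor A) = contractCap Y * A := by
  ext x y
  simp only [contractCap, mul_idTensor_cons]
  simp only [mul_apply, contractCap, Finset.sum_mul]
  exact Finset.sum_comm

lemma contractCap_insertCup (X : Matrix (Fin l → Fin N) (Fin m → Fin N) ℂ) :
    contractCap (insertCup X) = (N : ℂ) • X := by
  ext x y
  simp [contractCap, insertCup_snoc_cons]

lemma mul_cupCap_cons {o : Type*} (Y : Matrix o (Fin (m + 2) → Fin N) ℂ) (z : o) (i j : Fin N)
    (y : Fin m → Fin N) : (Y * cupCap N m) z (Fin.cons i (Fin.cons j y)) =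
      if i = j then ∑ h, Y z (Fin.cons h (Fin.cons h y)) else 0 := by
  have h1 : ∀ (a b : Fin N) (u : Fin m → Fin N),
    (Fin.cons a (Fin.cons b u) : Fin (m + 2) → Fin N) 1 = b := fun _ _ _ => rfl
  rw [mul_apply, sum_cons]
  simp only [sum_cons (k := m), cupCap, Fin.cons_zero, h1, Fin.tail_cons]
  by_cases h : i = j <;> simp [h, ite_and]

lemma cupCapR_mul_snoc {o : Type*} (Y : Matrix (Fin (l + 2) → Fin N) o ℂ) (z : o) (i j : Fin N)
    (x : Fin l → Fin N) : (cupCapR N l * Y) (Fin.snoc (Fin.snoc x j) i) z =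
      if i = j then ∑ h, Y (Fin.snoc (Fin.snoc x h) h) z else 0 := by
  have hr : ∀ (a b : Fin N) (u : Fin l → Fin N), revWord N (l + 2) (Fin.snoc (Fin.snoc u b) a) =
      Fin.cons a (Fin.cons b (revWord N l u)) := by
    intro a b u
    simp only [revWord_apply, Fin.snoc_comp_rev]
  have h1 : ∀ (a b : Fin N) (u : Fin l → Fin N),
    (Fin.cons a (Fin.cons b u) : Fin (l + 2) → Fin N) 1 = b := fun _ _ _ => rfl
  rw [mul_apply, sum_snoc]
  simp only [sum_snoc (k := l), cupCapR, cupCap, submatrix_apply, hr, Fin.cons_zero, h1,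
    Fin.tail_cons, (revWord N l).injective.eq_iff]
  by_cases h : i = j <;> simp [h, ite_and]

lemma contractCap_cupCapR_mul_insertCup (X : Matrix (Fin (l + 1) → Fin N) (Fin m → Fin N) ℂ) :
    contractCap (cupCapR N l * insertCup X) = X := by
  ext x y
  obtain ⟨i, x, rfl⟩ := exists_eq_snoc x
  simp [contractCap, cupCapR_mul_snoc, insertCup_snoc_cons]

lemma contractCap_insertCup_mul_cupCap (X : Matrix (Fin l → Fin N) (Fin (m + 1) → Fin N) ℂ) :
    contractCap (insertCup X * cupCap N m) = X := by
  ext x y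
  obtain ⟨i, y, rfl⟩ := exists_eq_cons y
  simp [contractCap, mul_cupCap_cons, insertCup_snoc_cons]

/-- The inner caps join the adjacent legs of `X` through the inserted cup, while the new outer cups
are joined by the contraction into a single cup. This exchange drives the induction on `r`. -/
lemma contractCap_cupCapR_mul_insertCup_mul_cupCap
    (X : Matrix (Fin (l + 1) → Fin N) (Fin (m + 1) → Fin N) ℂ) :
    contractCap (cupCapR N l * insertCup X * cupCap N m) = insertCup (contractCap X) := by
  ext x y
  obtain ⟨i, x, rfl⟩ := exists_eq_snoc x
  obtain ⟨j, y, rfl⟩ := exists_eq_cons y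
  simp [contractCap, mul_cupCap_cons, cupCapR_mul_snoc, insertCup_snoc_cons, eq_comm]

/-- The operator `p_l ⊗ p_m`. -/
def jwBoth (X : Matrix (Fin l → Fin N) (Fin m → Fin N) ℂ) :
    Matrix (Fin l → Fin N) (Fin m → Fin N) ℂ :=
  jonesWenzl N l * X * jonesWenzl N m

lemma jwBoth_jwBoth (hN : 3 ≤ N) (X : Matrix (Fin l → Fin N) (Fin m → Fin N) ℂ) :
    jwBoth (jwBoth X) = jwBoth X := by
  simp only [jwBoth, Matrix.mul_assoc, jonesWenzl_mul_self hN]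
  rw [← Matrix.mul_assoc, jonesWenzl_mul_self hN]

/-- Larger Jones-Wenzl projections absorb smaller ones, so projecting after each cup or only at the
end gives the same result. -/
lemma jwBoth_insertCup_jwBoth (hN : 3 ≤ N) (X : Matrix (Fin l → Fin N) (Fin m → Fin N) ℂ) :
    jwBoth (insertCup (jwBoth X)) = jwBoth (insertCup X) := by
  have : insertCup (jwBoth X) = tensorId (jonesWenzl N l) * insertCup X *
      idTensor (jonesWenzl N m) := by
    rw [tensorId_mul_insertCup, insertCup_mul_idTensor, jwBoth]
  rw [this, jwBoth, jwBoth, ← Matrix.mul_assoc, ← Matrix.mul_assoc, jonesWenzl_mul_tensorId hN,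
    Matrix.mul_assoc, idTensor_mul_jonesWenzl hN]

/-- The operator `T₁ T₁^*` on the last two legs, if there are two. -/
def capR (N : ℕ) : (l : ℕ) → Matrix (Fin (l + 1) → Fin N) (Fin (l + 1) → Fin N) ℂ
  | 0 => 0
  | l + 1 => cupCapR N l

/-- The operator `T₁ T₁^*` on the first two legs, if there are two. -/
def capL (N : ℕ) : (l : ℕ) → Matrix (Fin (l + 1) → Fin N) (Fin (l + 1) → Fin N) ℂ
  | 0 => 0
  | l + 1 => cupCap N l

lemma wenzlCoeff_zero : wenzlCoeff N 0 = 0 := by simp [wenzlCoeff, qInt_zero]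

lemma tensorId_one : tensorId (1 : Matrix (Fin l → Fin N) (Fin l → Fin N) ℂ) = 1 := by
  ext x y
  obtain ⟨i, x, rfl⟩ := exists_eq_snoc x
  obtain ⟨j, y, rfl⟩ := exists_eq_snoc y
  by_cases h : i = j <;> simp [tensorId_snoc, h, one_apply]

/-- Includes `l = 0`, where the coefficient vanishes and the default value of `capR` is irrelevant.
-/
lemma jonesWenzl_succ_right (hN : 3 ≤ N) (l : ℕ) :
    jonesWenzl N (l + 1) = tensorId (jonesWenzl N l) - (wenzlCoeff N l : ℂ) •
      (tensorId (jonesWenzl N l) * capR N l * tensorId (jonesWenzl N l)) := by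
  cases l with
  | zero => rw [wenzlCoeff_zero, Complex.ofReal_zero, zero_smul, sub_zero, jonesWenzl_zero,
      tensorId_one]; rfl
  | succ l => exact jonesWenzl_succ_succ_right hN l

lemma jonesWenzl_succ_left (l : ℕ) :
    jonesWenzl N (l + 1) = idTensor (jonesWenzl N l) - (wenzlCoeff N l : ℂ) •
      (idTensor (jonesWenzl N l) * capL N l * idTensor (jonesWenzl N l)) := by
  cases l with
  | zero => rw [wenzlCoeff_zero, Complex.ofReal_zero, zero_smul, sub_zero, jonesWenzl_zero,
      idTensor_one]; rfl
  | succ l => exact jonesWenzl_succ_succ l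

lemma wenzlCoeff_smul_contractCap_capR (X : Matrix (Fin l → Fin N) (Fin m → Fin N) ℂ) :
    (wenzlCoeff N l : ℂ) • contractCap (capR N l * insertCup X) = (wenzlCoeff N l : ℂ) • X := by
  cases l with
  | zero => simp [wenzlCoeff_zero]
  | succ l => rw [capR, contractCap_cupCapR_mul_insertCup]

lemma wenzlCoeff_smul_contractCap_capL (X : Matrix (Fin l → Fin N) (Fin m → Fin N) ℂ) :
    (wenzlCoeff N m : ℂ) • contractCap (insertCup X * capL N m) = (wenzlCoeff N m : ℂ) • X := by
  cases m with
  | zero => simp [wenzlCoeff_zero]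
  | succ m => rw [capL, contractCap_insertCup_mul_cupCap]

/-- Expand the left factor by the right-handed recursion and the right factor by the left-handed
one, so that both corrections act next to the new cup. The four terms are a loop `N`, two zigzags
that straighten to `X`, and the cross term. -/
lemma contractCap_jwBoth_insertCup (hN : 3 ≤ N) {X : Matrix (Fin l → Fin N) (Fin m → Fin N) ℂ}
    (hX : jwBoth X = X) :
    contractCap (jwBoth (insertCup X)) =
      ((N : ℂ) - wenzlCoeff N l - wenzlCoeff N m) • X + ((wenzlCoeff N l : ℂ) * wenzlCoeff N m) •
        jwBoth (contractCap (capR N l * insertCup X * capL N m)) := by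
  have hl : jonesWenzl N l * X = X := by
    rw [← hX, jwBoth, ← Matrix.mul_assoc, ← Matrix.mul_assoc, jonesWenzl_mul_self hN]
  have hm : X * jonesWenzl N m = X := by
    rw [← hX, jwBoth, Matrix.mul_assoc, jonesWenzl_mul_self hN]
  have hUl : tensorId (jonesWenzl N l) * insertCup X = insertCup X := by
    rw [tensorId_mul_insertCup, hl]
  have hUm : insertCup X * idTensor (jonesWenzl N m) = insertCup X := by
    rw [insertCup_mul_idTensor, hm]
  have hleft : jonesWenzl N (l + 1) * insertCup X = insertCup X -
      (wenzlCoeff N l : ℂ) • (tensorId (jonesWenzl N l) * (capR N l * insertCup X)) := by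
    rw [jonesWenzl_succ_right hN, Matrix.sub_mul, Matrix.smul_mul, hUl, Matrix.mul_assoc, hUl,
      Matrix.mul_assoc]
  have hright : insertCup X * jonesWenzl N (m + 1) = insertCup X -
      (wenzlCoeff N m : ℂ) • (insertCup X * capL N m * idTensor (jonesWenzl N m)) := by
    rw [jonesWenzl_succ_left, Matrix.mul_sub, Matrix.mul_smul, hUm, ← Matrix.mul_assoc,
      ← Matrix.mul_assoc, hUm]
  have hcross : tensorId (jonesWenzl N l) * (capR N l * insertCup X) * jonesWenzl N (m + 1) =
      tensorId (jonesWenzl N l) * (capR N l * insertCup X) - (wenzlCoeff N m : ℂ) •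
        (tensorId (jonesWenzl N l) * (capR N l * insertCup X * capL N m) *
          idTensor (jonesWenzl N m)) := by
    rw [Matrix.mul_assoc, Matrix.mul_assoc (capR N l), hright, Matrix.mul_sub, Matrix.mul_sub,
      Matrix.mul_smul, Matrix.mul_smul]
    simp only [Matrix.mul_assoc]
  rw [jwBoth, hleft, Matrix.sub_mul, hright, Matrix.smul_mul, hcross]
  simp only [smul_sub, contractCap_sub, contractCap_smul, contractCap_insertCup,
    contractCap_tensorId_mul, contractCap_mul_idTensor]
  rw [← Matrix.smul_mul, wenzlCoeff_smul_contractCap_capL, ← Matrix.mul_smul,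
    wenzlCoeff_smul_contractCap_capR, Matrix.mul_smul, Matrix.smul_mul, hl, hm, jwBoth, smul_smul]
  simp only [sub_smul]
  abel

end Insertion

/-! ### The three-vertices as matrices -/

section Spread
open Matrix

variable {N l m a b : ℕ}

/-- The map `ι ⊗ T_r ⊗ ι : (ℂ^N)^{⊗ (a + b)} → (ℂ^N)^{⊗ (a + r)} ⊗ (ℂ^N)^{⊗ (b + r)}`. -/
def insertCups (ξ : (Fin (a + b) → Fin N) → ℂ) :
    (r : ℕ) → Matrix (Fin (a + r) → Fin N) (Fin (b + r) → Fin N) ℂ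
  | 0 => fun x y => ξ (Fin.append x y)
  | r + 1 => insertCup (insertCups ξ r)

lemma append_update_left (x : Fin a → Fin N) (y : Fin b → Fin N) (i : Fin a) (h : Fin N) :
    Fin.append (Function.update x i h) y =
      Function.update (Fin.append x y) (Fin.castAdd b i) h := by
  funext j
  refine Fin.addCases (fun j => ?_) (fun j => ?_) j
  · rw [Fin.append_left]
    by_cases hj : j = i
    · subst hj; simp
    · rw [Function.update_of_ne hj, Function.update_of_ne, Fin.append_left]
      simpa [Fin.ext_iff] using hj
  · rw [Fin.append_right, Function.update_of_ne, Fin.append_right]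
    have := i.2
    simp only [ne_eq, Fin.ext_iff, Fin.val_natAdd, Fin.val_castAdd]
    omega

lemma append_update_right (x : Fin a → Fin N) (y : Fin b → Fin N) (i : Fin b) (h : Fin N) :
    Fin.append x (Function.update y i h) =
      Function.update (Fin.append x y) (Fin.natAdd a i) h := by
  funext j
  refine Fin.addCases (fun j => ?_) (fun j => ?_) j
  · rw [Fin.append_left, Function.update_of_ne, Fin.append_left]
    have := j.2
    simp only [ne_eq, Fin.ext_iff, Fin.val_natAdd, Fin.val_castAdd]
    omega
  · rw [Fin.append_right]
    by_cases hj : j = i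
    · subst hj; simp
    · rw [Function.update_of_ne hj, Function.update_of_ne, Fin.append_right]
      simpa [Fin.ext_iff] using hj

lemma CapFree.append_left {ξ : (Fin (a + b) → Fin N) → ℂ} (hξ : CapFree ξ) (y : Fin b → Fin N) :
    CapFree fun x : Fin a → Fin N => ξ (Fin.append x y) := by
  intro i j hij x
  simp only [append_update_left]
  exact hξ _ _ (by simpa using hij) _

lemma CapFree.append_right {ξ : (Fin (a + b) → Fin N) → ℂ} (hξ : CapFree ξ) (x : Fin a → Fin N) :
    CapFree fun y : Fin b → Fin N => ξ (Fin.append x y) := by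
  intro i j hij y
  simp only [append_update_right]
  exact hξ _ _ (by simp only [Fin.val_natAdd]; omega) _

lemma jwBoth_insertCups_zero {ξ : (Fin (a + b) → Fin N) → ℂ} (hξ : CapFree ξ) :
    jwBoth (insertCups ξ 0) = insertCups ξ 0 := by
  have h1 : jonesWenzl N (a + 0) * insertCups ξ 0 = insertCups ξ 0 := by
    ext x y
    exact congrFun (hξ.append_left y).jonesWenzl_mulVec x
  have h2 : insertCups ξ 0 * jonesWenzl N (b + 0) = insertCups ξ 0 := by
    ext x y
    have := congrFun (hξ.append_right x).jonesWenzl_mulVec y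
    rw [← jonesWenzl_transpose, mulVec_transpose] at this
    exact this
  rw [jwBoth, h1, h2]

lemma contractCap_insertCups_zero {ξ : (Fin (a + 1 + (b + 1)) → Fin N) → ℂ} (hξ : CapFree ξ) :
    contractCap (insertCups ξ 0 :
      Matrix (Fin (a + 1) → Fin N) (Fin (b + 1) → Fin N) ℂ) = 0 := by
  ext x y
  rcases Nat.eq_zero_or_pos N with rfl | hN
  · simp [contractCap]
  · have := hξ (Fin.castAdd (b + 1) (Fin.last a)) (Fin.natAdd (a + 1) 0) (by simp)
      (Fin.append (Fin.snoc x ⟨0, hN⟩) (Fin.cons ⟨0, hN⟩ y))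
    simp only [← append_update_left, ← append_update_right, Fin.update_snoc_last,
      Fin.update_cons_zero] at this
    exact this

/-- Only the cross term depends on more than `N` and the Wenzl coefficients: it vanishes without
cups and otherwise returns the scalar of the previous stage. -/
lemma contractCap_jwBoth_insertCup_insertCups (hN : 3 ≤ N) {ξ : (Fin (a + b) → Fin N) → ℂ}
    (hξ : CapFree ξ) (r : ℕ) :
    contractCap (jwBoth (insertCup (jwBoth (insertCups ξ r)))) =
      (thetaStep (qParam N) a b r : ℂ) • jwBoth (insertCups ξ r) := by
  have h0 := qParam_pos hN
  have h1 := qParam_lt_one hN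
  have hNq : (N : ℂ) = ((qParam N + (qParam N)⁻¹ : ℝ) : ℂ) := by
    rw [qParam_add_inv hN, Complex.ofReal_natCast]
  induction r with
  | zero =>
    rw [contractCap_jwBoth_insertCup hN (jwBoth_jwBoth hN _), jwBoth_insertCups_zero hξ]
    -- If `a` or `b` is 0, a coefficient vanishes; otherwise the cross term contracts two
    -- neighbouring legs of the cap-free `ξ`.
    have h2 : ((wenzlCoeff N (a + 0) : ℂ) * wenzlCoeff N (b + 0)) •
        jwBoth (contractCap (capR N (a + 0) * insertCup (insertCups ξ 0) * capL N (b + 0))) = 0 := by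
      cases a with
      | zero =>
        have h3 : wenzlCoeff N (0 + 0) = 0 := wenzlCoeff_zero
        rw [h3, Complex.ofReal_zero, zero_mul, zero_smul]
      | succ a =>
        cases b with
        | zero =>
          have h3 : wenzlCoeff N (0 + 0) = 0 := wenzlCoeff_zero
          rw [h3, Complex.ofReal_zero, mul_zero, zero_smul]
        | succ b =>
          have := contractCap_cupCapR_mul_insertCup_mul_cupCap (insertCups ξ 0 :
            Matrix (Fin (a + 1) → Fin N) (Fin (b + 1) → Fin N) ℂ)
          rw [contractCap_insertCups_zero hξ, insertCup_zero] at this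
          have h3 : contractCap (capR N (a + 1 + 0) * insertCup (insertCups ξ 0) *
            capL N (b + 1 + 0)) = 0 := this
          rw [h3, jwBoth, Matrix.mul_zero, Matrix.zero_mul, smul_zero]
    rw [h2]
    refine (add_zero _).trans (congrArg (· • insertCups ξ 0) ?_)
    rw [thetaStep_zero h0 h1, hNq]
    simp only [wenzlCoeff, Nat.add_zero]
    push_cast
    rfl
  | succ r ih =>
    rw [contractCap_jwBoth_insertCup hN (jwBoth_jwBoth hN _)]
    have h2 : contractCap (capR N (a + (r + 1)) * insertCup (jwBoth (insertCups ξ (r + 1))) *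
        capL N (b + (r + 1))) = insertCup (contractCap (jwBoth (insertCup (insertCups ξ r)))) :=
      contractCap_cupCapR_mul_insertCup_mul_cupCap _
    have h3 : ∀ (c : ℂ) (X : Matrix (Fin (a + (r + 1)) → Fin N) (Fin (b + (r + 1)) → Fin N) ℂ),
        jwBoth (c • X) = c • jwBoth X := fun c X => by
      rw [jwBoth, Matrix.mul_smul, Matrix.smul_mul, jwBoth]
    have h4 : jwBoth (insertCup (jwBoth (insertCups ξ r)) :
        Matrix (Fin (a + (r + 1)) → Fin N) (Fin (b + (r + 1)) → Fin N) ℂ) =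
        jwBoth (insertCups ξ (r + 1)) := jwBoth_insertCup_jwBoth hN _
    rw [jwBoth_insertCup_jwBoth hN] at ih
    rw [h2, ih, insertCup_smul]
    refine (congrArg _ (congrArg _ ((h3 _ _).trans (congrArg _ h4)))).trans ?_
    rw [smul_smul, ← add_smul, thetaStep_succ h0 h1, hNq]
    simp only [wenzlCoeff]
    push_cast
    rfl

/-! ### Hilbert-Schmidt norms of projected cup insertions -/

/-- The square of the Hilbert-Schmidt norm. -/
def frobSq (X : Matrix (Fin l → Fin N) (Fin m → Fin N) ℂ) : ℝ := ∑ x, ∑ y, ‖X x y‖ ^ 2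

/-- The Hilbert-Schmidt inner product. -/
def frobInner (X Y : Matrix (Fin l → Fin N) (Fin m → Fin N) ℂ) : ℂ := ∑ x, ∑ y, star (X x y) * Y x y

lemma frobInner_self (X : Matrix (Fin l → Fin N) (Fin m → Fin N) ℂ) :
    frobInner X X = frobSq X := by
  simp only [frobInner, frobSq, Complex.ofReal_sum, Complex.ofReal_pow]
  refine Finset.sum_congr rfl fun x _ => Finset.sum_congr rfl fun y _ => ?_
  exact Complex.conj_mul' _

lemma frobInner_smul (c : ℂ) (X Y : Matrix (Fin l → Fin N) (Fin m → Fin N) ℂ) :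
    frobInner X (c • Y) = c * frobInner X Y := by
  simp only [frobInner, Finset.mul_sum, Matrix.smul_apply, smul_eq_mul]
  exact Finset.sum_congr rfl fun x _ => Finset.sum_congr rfl fun y _ => by ring

lemma frobInner_insertCup (X : Matrix (Fin l → Fin N) (Fin m → Fin N) ℂ)
    (Y : Matrix (Fin (l + 1) → Fin N) (Fin (m + 1) → Fin N) ℂ) :
    frobInner (insertCup X) Y = frobInner X (contractCap Y) := by
  simp only [frobInner, sum_snoc (k := l), sum_cons (k := m), insertCup_snoc_cons, contractCap,
    Finset.mul_sum]
  rw [Finset.sum_comm]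
  refine Finset.sum_congr rfl fun x _ => ?_
  rw [Finset.sum_comm' (t' := Finset.univ) (s' := fun _ => Finset.univ) (by simp)]
  rw [Finset.sum_comm]
  conv_rhs => rw [Finset.sum_comm]
  refine Finset.sum_congr rfl fun i _ => ?_
  rw [Finset.sum_eq_single i]
  · simp
  · intro j _ hj
    simp [hj.symm]
  · simp

lemma frobInner_eq_trace (X Y : Matrix (Fin l → Fin N) (Fin m → Fin N) ℂ) :
    frobInner X Y = (Xᴴ * Y).trace := by
  simp only [frobInner, trace, diag, mul_apply, conjTranspose_apply]
  exact Finset.sum_comm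

lemma jonesWenzl_conjTranspose (k : ℕ) : (jonesWenzl N k)ᴴ = jonesWenzl N k := by
  rw [conjTranspose, jonesWenzl_transpose, jonesWenzl_map_star]

lemma frobInner_jwBoth (X Y : Matrix (Fin l → Fin N) (Fin m → Fin N) ℂ) :
    frobInner (jwBoth X) Y = frobInner X (jwBoth Y) := by
  rw [frobInner_eq_trace, frobInner_eq_trace, jwBoth, jwBoth, conjTranspose_mul, conjTranspose_mul,
    jonesWenzl_conjTranspose, jonesWenzl_conjTranspose, Matrix.mul_assoc, trace_mul_comm]
  simp only [Matrix.mul_assoc]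

/-- `p_{l+1} ⊗ p_{m+1}` is a self-adjoint idempotent and `contractCap` is adjoint to `insertCup`, so
the norm only sees their composite. -/
lemma frobSq_jwBoth_insertCup (hN : 3 ≤ N) {X : Matrix (Fin l → Fin N) (Fin m → Fin N) ℂ} {c : ℝ}
    (h : contractCap (jwBoth (insertCup X)) = (c : ℂ) • X) :
    frobSq (jwBoth (insertCup X)) = c * frobSq X := by
  have : (frobSq (jwBoth (insertCup X)) : ℂ) = c * frobSq X := by
    rw [← frobInner_self, frobInner_jwBoth, jwBoth_jwBoth hN, frobInner_insertCup, h,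
      frobInner_smul, frobInner_self]
  exact_mod_cast this

lemma frobSq_insertCups_zero (ξ : (Fin (a + b) → Fin N) → ℂ) :
    frobSq (insertCups ξ 0) = ∑ z, ‖ξ z‖ ^ 2 := by
  rw [← (Fin.appendEquiv a b).sum_comp, Fintype.sum_prod_type]
  rfl

/-- The norm of the three-vertex on cap-free tensors. -/
lemma frobSq_jwBoth_insertCups (hN : 3 ≤ N) {ξ : (Fin (a + b) → Fin N) → ℂ} (hξ : CapFree ξ)
    (r : ℕ) : frobSq (jwBoth (insertCups ξ r)) =
      (∏ s ∈ Finset.range r, thetaStep (qParam N) a b s) * ∑ z, ‖ξ z‖ ^ 2 := by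
  induction r with
  | zero =>
    rw [jwBoth_insertCups_zero hξ, frobSq_insertCups_zero, Finset.range_zero, Finset.prod_empty,
      one_mul]
  | succ r ih =>
    have h : frobSq (jwBoth (insertCups ξ (r + 1))) =
        thetaStep (qParam N) a b r * frobSq (jwBoth (insertCups ξ r)) := by
      rw [← frobSq_jwBoth_insertCup hN (contractCap_jwBoth_insertCup_insertCups hN hξ r),
        jwBoth_insertCup_jwBoth hN]
      rfl
    rw [h, ih, Finset.prod_range_succ]
    ring

/-! ### Overlaps with product vectors -/

/-- The `ℓ²` norm. -/
def l2norm {κ : Type*} [Fintype κ] (v : κ → ℂ) : ℝ := √(∑ x, ‖v x‖ ^ 2)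

lemma l2norm_sq {κ : Type*} [Fintype κ] (v : κ → ℂ) : l2norm v ^ 2 = ∑ x, ‖v x‖ ^ 2 :=
  Real.sq_sqrt (by positivity)

/-- Group by the letter carried by the cup and apply Cauchy-Schwarz over that letter. Against
product vectors a cup thus costs nothing, although `T₁` itself has norm `√N`. -/
lemma norm_sum_insertCup_le {X : Matrix (Fin l → Fin N) (Fin m → Fin N) ℂ} {c : ℝ} (hc : 0 ≤ c)
    (hX : ∀ η ζ, ‖∑ x, ∑ y, X x y * (η x * ζ y)‖ ≤ c * (l2norm η * l2norm ζ))
    (η : (Fin (l + 1) → Fin N) → ℂ) (ζ : (Fin (m + 1) → Fin N) → ℂ) :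
    ‖∑ x, ∑ y, insertCup X x y * (η x * ζ y)‖ ≤ c * (l2norm η * l2norm ζ) := by
  have h1 : ∑ x, ∑ y, insertCup X x y * (η x * ζ y) =
      ∑ i, ∑ x, ∑ y, X x y * (η (Fin.snoc x i) * ζ (Fin.cons i y)) := by
    rw [sum_snoc (k := l)]
    refine Finset.sum_congr rfl fun i _ => Finset.sum_congr rfl fun x _ => ?_
    rw [sum_cons (k := m), Finset.sum_eq_single i]
    · refine Finset.sum_congr rfl fun y _ => ?_
      rw [insertCup_snoc_cons, if_pos rfl]
    · intro j _ hj
      refine Finset.sum_eq_zero fun y _ => ?_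
      rw [insertCup_snoc_cons, if_neg hj.symm, zero_mul]
    · simp
  have h2 : l2norm η = √(∑ i, l2norm (fun x : Fin l → Fin N => η (Fin.snoc x i)) ^ 2) := by
    simp only [l2norm_sq]
    rw [l2norm, sum_snoc (k := l)]
  have h3 : l2norm ζ = √(∑ i, l2norm (fun x : Fin m → Fin N => ζ (Fin.cons i x)) ^ 2) := by
    simp only [l2norm_sq]
    rw [l2norm, sum_cons (k := m)]
  rw [h1, h2, h3]
  refine (norm_sum_le _ _).trans ((Finset.sum_le_sum fun i _ => hX _ _).trans ?_)
  rw [← Finset.mul_sum]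
  exact mul_le_mul_of_nonneg_left (Real.sum_mul_le_sqrt_mul_sqrt _ _ _) hc

lemma norm_sum_insertCups_le (ξ : (Fin (a + b) → Fin N) → ℂ) (r : ℕ)
    (η : (Fin (a + r) → Fin N) → ℂ) (ζ : (Fin (b + r) → Fin N) → ℂ) :
    ‖∑ x, ∑ y, insertCups ξ r x y * (η x * ζ y)‖ ≤ l2norm ξ * (l2norm η * l2norm ζ) := by
  induction r with
  | zero =>
    have h1 : ∑ x : Fin a → Fin N, ∑ y : Fin b → Fin N, insertCups ξ 0 x y * (η x * ζ y) =
        ∑ p : (Fin a → Fin N) × (Fin b → Fin N), ξ (Fin.append p.1 p.2) * (η p.1 * ζ p.2) := by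
      rw [Fintype.sum_prod_type]
      rfl
    have h2 : l2norm ξ = √(∑ p : (Fin a → Fin N) × (Fin b → Fin N),
        ‖ξ (Fin.append p.1 p.2)‖ ^ 2) := by
      rw [l2norm, ← (Fin.appendEquiv a b).sum_comp]
      rfl
    have h3 : l2norm η * l2norm ζ = √(∑ p : (Fin a → Fin N) × (Fin b → Fin N),
        (‖η p.1‖ * ‖ζ p.2‖) ^ 2) := by
      rw [l2norm, l2norm, ← Real.sqrt_mul (by positivity), Fintype.sum_prod_type,
        Finset.sum_mul_sum]
      simp only [mul_pow]
      rfl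
    erw [h1]
    rw [h2, h3]
    refine (norm_sum_le _ _).trans ?_
    simp only [norm_mul]
    exact Real.sum_mul_le_sqrt_mul_sqrt _ _ _
  | succ r ih =>
    exact norm_sum_insertCup_le (Real.sqrt_nonneg _) ih η ζ

/-! ### Reduced words -/

/-- A word is reduced if adjacent letters are distinct. -/
def Reduced {k : ℕ} (x : Fin k → Fin N) : Prop := ∀ i j : Fin k, (i : ℕ) + 1 = j → x i ≠ x j

/-- A contraction only sees words with two equal neighbouring letters. -/
lemma Reduced.capFree {k : ℕ} {x : Fin k → Fin N} (hx : Reduced x) :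
    CapFree (Pi.single x (1 : ℂ)) := by
  intro i j hij y
  refine Finset.sum_eq_zero fun h _ => Pi.single_eq_of_ne ?_ _
  rintro rfl
  have hne : i ≠ j := by rintro rfl; omega
  exact hx i j hij (by simp [Function.update_of_ne hne])

lemma Reduced.snoc {k : ℕ} {x : Fin k → Fin N} (hx : Reduced x) {h : Fin N}
    (hh : ∀ i : Fin k, (i : ℕ) + 1 = k → x i ≠ h) :
    Reduced (Fin.snoc x h : Fin (k + 1) → Fin N) := by
  intro i j hij
  induction i using Fin.lastCases with
  | last => simp only [Fin.val_last] at hij; omega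
  | cast i =>
    rw [Fin.snoc_castSucc]
    induction j using Fin.lastCases with
    | last => rw [Fin.snoc_last]; exact hh i (by simpa using hij)
    | cast j => rw [Fin.snoc_castSucc]; exact hx i j (by simpa using hij)

lemma Reduced.cons {k : ℕ} {x : Fin k → Fin N} (hx : Reduced x) {h : Fin N}
    (hh : ∀ i : Fin k, (i : ℕ) = 0 → x i ≠ h) :
    Reduced (Fin.cons h x : Fin (k + 1) → Fin N) := by
  intro i j hij
  induction j using Fin.cases with
  | zero => simp at hij
  | succ j =>
    rw [Fin.cons_succ]
    induction i using Fin.cases with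
    | zero => rw [Fin.cons_zero]; exact (hh j (by simpa using hij.symm)).symm
    | succ i => rw [Fin.cons_succ]; exact hx i j (by simpa using hij)

/-- There are `(N - 2) (N - 1) ^ r` pairs of reduced words extending a fixed reduced word of length
`a + b` by a reduced word of length `r + 1` and its reverse. -/
lemma exists_reduced_words (hN : 3 ≤ N) (a b r : ℕ) :
    ∃ z : Fin (a + b) → Fin N, Reduced z ∧ ∃ (x : Fin ((N - 2) * (N - 1) ^ r) → Fin (a + (r + 1)) → Fin N)
      (y : Fin ((N - 2) * (N - 1) ^ r) → Fin (b + (r + 1)) → Fin N),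
      Function.Injective x ∧ Function.Injective y ∧ ∀ i, Reduced (x i) ∧ Reduced (y i) ∧
        x i (Fin.last (a + r)) = y i (0 : Fin (b + r + 1)) ∧
        insertCups (Pi.single z (1 : ℂ)) (r + 1) (x i) (y i) = 1 := by
  -- The fixed word alternates between the letters 0 and 1, leaving `N - 2` letters that may follow
  -- or precede any of its pieces.
  let alt : ℕ → Fin N := fun j => if j % 2 = 0 then ⟨0, by omega⟩ else ⟨1, by omega⟩
  have halt : ∀ j, alt j ≠ alt (j + 1) := fun j => by
    simp only [alt]
    rcases Nat.mod_two_eq_zero_or_one j with h | h <;> simp [h, Nat.add_mod]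
  have hlt : ∀ j, (alt j : ℕ) < 2 := fun j => by
    simp only [alt]
    split_ifs <;> simp
  refine ⟨fun j => alt j, fun i j hij => by simp only [← hij]; exact halt _, ?_⟩
  set ξ : (Fin (a + b) → Fin N) → ℂ := Pi.single (fun j => alt j) 1 with hξ
  induction r with
  | zero =>
    let u : Fin ((N - 2) * (N - 1) ^ 0) → Fin N := fun i =>
      ⟨i + 2, by have := i.2; simp only [pow_zero, mul_one] at this; omega⟩
    have hu : Function.Injective u := fun i j hij => by
      exact Fin.ext (by simpa [u] using hij)
    let x0 : Fin a → Fin N := fun j => alt j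
    let y0 : Fin b → Fin N := fun j => alt (a + j)
    have hne : ∀ j i, alt j ≠ u i := fun j i h => by
      have := hlt j
      rw [h] at this
      simp [u] at this
    have hx0 : Reduced x0 := fun i j hij => by
      simp only [x0, ← hij]; exact halt _
    have hy0 : Reduced y0 := fun i j hij => by
      simp only [y0, ← hij, ← add_assoc]; exact halt _
    refine ⟨fun i => (Fin.snoc x0 (u i) : Fin (a + 1) → Fin N),
      fun i => (Fin.cons (u i) y0 : Fin (b + 1) → Fin N), ?_, ?_, fun i => ⟨?_, ?_, ?_, ?_⟩⟩
    · intro i j hij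
      exact hu (Fin.snoc_injective2 hij).2
    · intro i j hij
      exact hu (Fin.cons_injective2 hij).1
    · exact hx0.snoc fun j _ => hne _ _
    · exact hy0.cons fun j _ => hne _ _
    · exact (Fin.snoc_last (α := fun _ => Fin N) _ _).trans (Fin.cons_zero (α := fun _ => Fin N) _ _).symm
    · have : insertCup (insertCups ξ 0) (Fin.snoc x0 (u i)) (Fin.cons (u i) y0) =
          insertCups ξ 0 x0 y0 := by
        rw [insertCup_snoc_cons, if_pos rfl]
      refine this.trans ?_
      have h2 : Fin.append x0 y0 = fun j : Fin (a + b) => alt j := by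
        funext j
        refine Fin.addCases (fun j => ?_) (fun j => ?_) j
        · simp [x0]
        · simp [y0]
      change ξ (Fin.append x0 y0) = 1
      rw [h2, hξ, Pi.single_eq_same]
  | succ r ih =>
    obtain ⟨x, y, hx, hy, h⟩ := ih
    have hcard : (N - 2) * (N - 1) ^ (r + 1) = (N - 2) * (N - 1) ^ r * (N - 1) := by
      rw [pow_succ, mul_assoc]
    let e : Fin ((N - 2) * (N - 1) ^ (r + 1)) ≃ Fin ((N - 2) * (N - 1) ^ r) × Fin (N - 1) :=
      (finCongr hcard).trans finProdFinEquiv.symm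
    obtain ⟨n, rfl⟩ : ∃ n, N = n + 1 := ⟨N - 1, by omega⟩
    -- `succAbove` enumerates the `N - 1` letters different from the last letter of `x`. That letter
    -- is also the first letter of `y`, so one choice keeps both words reduced.
    let w : Fin ((n + 1 - 2) * (n + 1 - 1) ^ (r + 1)) → Fin (n + 1) := fun i =>
      (x (e i).1 (Fin.last (a + r))).succAbove (e i).2
    have hw : ∀ i j, (e i).1 = (e j).1 → w i = w j → i = j := by
      intro i j h1 h2
      refine e.injective (Prod.ext h1 ?_)
      simp only [w, h1] at h2
      exact Fin.succAbove_right_injective h2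
    refine ⟨fun i => (Fin.snoc (x (e i).1) (w i) : Fin (a + (r + 1) + 1) → Fin (n + 1)),
      fun i => (Fin.cons (w i) (y (e i).1) : Fin (b + (r + 1) + 1) → Fin (n + 1)), ?_, ?_,
      fun i => ⟨?_, ?_, ?_, ?_⟩⟩
    · intro i j hij
      have := Fin.snoc_injective2 hij
      exact hw i j (hx this.1) this.2
    · intro i j hij
      have := Fin.cons_injective2 hij
      exact hw i j (hy this.2) this.1
    · refine (h (e i).1).1.snoc fun j hj => ?_
      obtain rfl : j = Fin.last (a + r) := Fin.ext (by simp only [Fin.val_last]; omega)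
      exact (Fin.succAbove_ne _ _).symm
    · refine (h (e i).1).2.1.cons fun j hj => ?_
      obtain rfl : j = (0 : Fin (b + r + 1)) := Fin.ext hj
      rw [← (h (e i).1).2.2.1]
      exact (Fin.succAbove_ne _ _).symm
    · exact (Fin.snoc_last (α := fun _ => Fin (n + 1)) _ _).trans
        (Fin.cons_zero (α := fun _ => Fin (n + 1)) _ _).symm
    · have : insertCup (insertCups ξ (r + 1)) (Fin.snoc (x (e i).1) (w i))
          (Fin.cons (w i) (y (e i).1)) = insertCups ξ (r + 1) (x (e i).1) (y (e i).1) := by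
        rw [insertCup_snoc_cons, if_pos rfl]
      exact this.trans (h _).2.2.2

end Spread

/-! ### Positivity in matrix algebras over operators -/

section Positivity
open scoped ComplexOrder InnerProductSpace
open InnerProductSpace

variable {H K : Type*} [NormedAddCommGroup H] [InnerProductSpace ℂ H] [CompleteSpace H]
  [NormedAddCommGroup K] [InnerProductSpace ℂ K] [CompleteSpace K] {d : ℕ}

lemma exists_eq_star_mul_self {T : K →L[ℂ] K} (hT : 0 ≤ T) : ∃ S, T = star S * S :=
  CStarAlgebra.nonneg_iff_eq_star_mul_self.1 hT

/-- The operator on `K ^ d` given by a matrix of operators on `K`. -/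
def matrixOp (M : CStarMatrix (Fin d) (Fin d) (K →L[ℂ] K)) :
    PiLp 2 (fun _ : Fin d => K) →L[ℂ] PiLp 2 (fun _ : Fin d => K) :=
  (PiLp.continuousLinearEquiv 2 ℂ (fun _ : Fin d => K)).symm.toContinuousLinearMap ∘L
    ContinuousLinearMap.pi fun i => ∑ j, M i j ∘L PiLp.proj 2 (fun _ : Fin d => K) j

omit [CompleteSpace K] in
lemma matrixOp_apply (M : CStarMatrix (Fin d) (Fin d) (K →L[ℂ] K))
    (f : PiLp 2 (fun _ : Fin d => K)) (i : Fin d) : matrixOp M f i = ∑ j, M i j (f j) := by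
  simp [matrixOp]

/-- The inclusion of a summand of `K ^ d`. -/
def inclAt (K : Type*) [NormedAddCommGroup K] [InnerProductSpace ℂ K] {d : ℕ} (j : Fin d) :
    K →L[ℂ] PiLp 2 (fun _ : Fin d => K) :=
  (PiLp.continuousLinearEquiv 2 ℂ (fun _ : Fin d => K)).symm.toContinuousLinearMap ∘L
    ContinuousLinearMap.single ℂ (fun _ : Fin d => K) j

omit [CompleteSpace K] in
lemma inclAt_apply (j i : Fin d) (y : K) : inclAt K j y i = if i = j then y else 0 := by
  simp [inclAt]

omit [CompleteSpace K] in
lemma inner_inclAt_left (j : Fin d) (y : K) (f : PiLp 2 (fun _ : Fin d => K)) :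
    ⟪inclAt K j y, f⟫_ℂ = ⟪y, f j⟫_ℂ := by
  rw [PiLp.inner_apply, Finset.sum_eq_single j]
  · rw [inclAt_apply, if_pos rfl]
  · intro i _ hi
    rw [inclAt_apply, if_neg hi, inner_zero_left]
  · simp

lemma inner_star_mul_self_apply (B : CStarMatrix (Fin d) (Fin d) (K →L[ℂ] K)) (i j : Fin d)
    (y y' : K) : ⟪y, (star B * B) i j y'⟫_ℂ = ∑ k, ⟪B k i y, B k j y'⟫_ℂ := by
  rw [CStarMatrix.mul_apply, sum_apply, inner_sum]
  refine Finset.sum_congr rfl fun k _ => ?_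
  rw [CStarMatrix.star_apply, mul_apply_eq_comp, ContinuousLinearMap.star_eq_adjoint,
    ContinuousLinearMap.adjoint_inner_right]

/-- View `M` as a positive operator on `K ^ d`, factor it as `S* S`, and cut `S` into blocks: they
form a matrix `B` with `M = B* B`. -/
lemma cstarMatrix_nonneg_of_inner {M : CStarMatrix (Fin d) (Fin d) (K →L[ℂ] K)}
    (hM : ∀ f : Fin d → K, 0 ≤ ∑ i, ∑ j, ⟪f i, M i j (f j)⟫_ℂ) : 0 ≤ M := by
  have hform : ∀ f : PiLp 2 (fun _ : Fin d => K),
      ⟪f, matrixOp M f⟫_ℂ = ∑ i, ∑ j, ⟪f i, M i j (f j)⟫_ℂ := fun f => by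
    simp only [PiLp.inner_apply, matrixOp_apply, inner_sum]
  have hT : 0 ≤ matrixOp M := by
    rw [ContinuousLinearMap.nonneg_iff_isPositive, ContinuousLinearMap.isPositive_iff_complex]
    intro f
    have h := hM f
    rw [← hform, Complex.nonneg_iff] at h
    have h2 : ⟪matrixOp M f, f⟫_ℂ = (starRingEnd ℂ) ⟪f, matrixOp M f⟫_ℂ :=
      (inner_conj_symm _ _).symm
    rw [h2]
    generalize ⟪f, matrixOp M f⟫_ℂ = z at h
    refine ⟨?_, by simpa using h.1⟩
    apply Complex.ext <;> simp [h.2.symm]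
  obtain ⟨S, hS⟩ := exists_eq_star_mul_self hT
  let B : CStarMatrix (Fin d) (Fin d) (K →L[ℂ] K) := CStarMatrix.ofMatrix fun k i =>
    PiLp.proj 2 (fun _ : Fin d => K) k ∘L S ∘L inclAt K i
  have hB : M = star B * B := by
    refine CStarMatrix.ext fun i j => ContinuousLinearMap.ext fun y' => ?_
    refine ext_inner_left ℂ fun y => ?_
    rw [inner_star_mul_self_apply]
    have h1 : ∑ k, ⟪B k i y, B k j y'⟫_ℂ = ⟪S (inclAt K i y), S (inclAt K j y')⟫_ℂ := by
      rw [PiLp.inner_apply]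
      rfl
    have h2 : ⟪S (inclAt K i y), S (inclAt K j y')⟫_ℂ =
        ⟪inclAt K i y, matrixOp M (inclAt K j y')⟫_ℂ := by
      rw [hS, mul_apply_eq_comp, ContinuousLinearMap.star_eq_adjoint,
        ContinuousLinearMap.adjoint_inner_right]
    rw [h1, h2, inner_inclAt_left, matrixOp_apply, Finset.sum_eq_single j]
    · rw [inclAt_apply, if_pos rfl]
    · intro k _ hk
      rw [inclAt_apply, if_neg hk, map_zero]
    · simp
  rw [hB]
  exact star_mul_self_nonneg B

/-- An additive functional that is nonnegative on squares is nonnegative on positive elements. -/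
lemma cstarMatrix_induction_nonneg {p : CStarMatrix (Fin d) (Fin d) (K →L[ℂ] K) → Prop}
    (h0 : p 0) (hadd : ∀ M M', p M → p M' → p (M + M')) (hB : ∀ B, p (star B * B))
    {M : CStarMatrix (Fin d) (Fin d) (K →L[ℂ] K)} (hM : 0 ≤ M) : p M := by
  rw [StarOrderedRing.nonneg_iff] at hM
  induction hM using AddSubmonoid.closure_induction with
  | mem x hx => obtain ⟨B, rfl⟩ := hx; exact hB B
  | zero => exact h0
  | add x y _ _ hx hy => exact hadd x y hx hy

lemma inner_nonneg_of_cstarMatrix_nonneg {M : CStarMatrix (Fin d) (Fin d) (K →L[ℂ] K)}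
    (hM : 0 ≤ M) (f : Fin d → K) : 0 ≤ ∑ i, ∑ j, ⟪f i, M i j (f j)⟫_ℂ := by
  refine cstarMatrix_induction_nonneg (p := fun M => 0 ≤ ∑ i, ∑ j, ⟪f i, M i j (f j)⟫_ℂ)
    ?_ ?_ ?_ hM
  · simp
  · intro M M' h h'
    simp only [CStarMatrix.add_apply, add_apply, inner_add_right,
      Finset.sum_add_distrib]
    exact add_nonneg h h'
  · intro B
    have : ∑ i, ∑ j, ⟪f i, (star B * B) i j (f j)⟫_ℂ =
        ∑ k, ⟪∑ i, B k i (f i), ∑ j, B k j (f j)⟫_ℂ := by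
      simp only [inner_star_mul_self_apply, sum_inner, inner_sum]
      exact ((Finset.sum_congr rfl fun i _ => Finset.sum_comm).trans Finset.sum_comm).trans
        (Finset.sum_congr rfl fun k _ => Finset.sum_comm)
    rw [this]
    exact Finset.sum_nonneg fun k _ => by
      rw [inner_self_eq_norm_sq_to_K, ← RCLike.ofReal_pow]
      exact RCLike.ofReal_nonneg.2 (sq_nonneg _)

end Positivity

/-! ### Choi matrices -/

section Choi
open scoped ComplexOrder InnerProductSpace
open InnerProductSpace

variable {ι H K : Type*} [Fintype ι] [NormedAddCommGroup H] [InnerProductSpace ℂ H]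
  [FiniteDimensional ℂ H] [CompleteSpace H] [NormedAddCommGroup K] [InnerProductSpace ℂ K]
  [FiniteDimensional ℂ K] [CompleteSpace K] (b : OrthonormalBasis ι ℂ H)

/-- The operator on `K` with matrix coefficients `⟪x ⊗ k, C (y ⊗ k')⟫`. -/
def slice (C : H ⊗[ℂ] K →ₗ[ℂ] H ⊗[ℂ] K) (x y : H) : K →L[ℂ] K :=
  LinearMap.toContinuousLinearMap
    (LinearMap.adjoint (TensorProduct.mk ℂ H K x) ∘ₗ C ∘ₗ TensorProduct.mk ℂ H K y)

omit [CompleteSpace H] [CompleteSpace K] in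
lemma inner_slice (C : H ⊗[ℂ] K →ₗ[ℂ] H ⊗[ℂ] K) (x y : H) (k k' : K) :
    ⟪k, slice C x y k'⟫_ℂ = ⟪x ⊗ₜ[ℂ] k, C (y ⊗ₜ[ℂ] k')⟫_ℂ := by
  rw [slice, LinearMap.coe_toContinuousLinearMap', LinearMap.comp_apply, LinearMap.comp_apply,
    LinearMap.adjoint_inner_right, TensorProduct.mk_apply, TensorProduct.mk_apply]

/-- The linear map with given Choi matrix. -/
def ofChoi (C : H ⊗[ℂ] K →ₗ[ℂ] H ⊗[ℂ] K) : (H →L[ℂ] H) →ₗ[ℂ] (K →L[ℂ] K) where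
  toFun X := ∑ i, ∑ j, ⟪b i, X (b j)⟫_ℂ • slice C (b i) (b j)
  map_add' X Y := by
    simp only [add_apply, inner_add_right, add_smul, Finset.sum_add_distrib]
  map_smul' c X := by
    simp only [smul_apply, inner_smul_right, mul_smul, Finset.smul_sum,
      RingHom.id_apply]

omit [FiniteDimensional ℂ H] [CompleteSpace H] [FiniteDimensional ℂ K] [CompleteSpace K] in
lemma inner_choi (Φ : (H →L[ℂ] H) →ₗ[ℂ] (K →L[ℂ] K)) (i j : ι) (k k' : K) :
    ⟪b i ⊗ₜ[ℂ] k, choi b Φ (b j ⊗ₜ[ℂ] k')⟫_ℂ = ⟪k, Φ (rankOne ℂ (b i) (b j)) k'⟫_ℂ := by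
  classical
  simp only [choi, LinearMap.sum_apply, TensorProduct.map_tmul, inner_sum,
    TensorProduct.inner_tmul, ContinuousLinearMap.coe_coe, inner_right_rankOne_apply,
    b.inner_eq_ite]
  rw [Finset.sum_eq_single i, Finset.sum_eq_single j]
  · simp
  · intro j' _ h
    simp [h]
  · simp
  · intro i' _ h
    simp [h.symm]
  · simp

omit [FiniteDimensional ℂ H] [CompleteSpace H] in
lemma eq_sum_rankOne (X : H →L[ℂ] H) :
    X = ∑ i, ∑ j, ⟪b i, X (b j)⟫_ℂ • rankOne ℂ (b i) (b j) := by
  ext x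
  simp only [sum_apply, smul_apply, rankOne_apply]
  conv_lhs => rw [← b.sum_repr' x, map_sum]
  rw [Finset.sum_comm]
  refine Finset.sum_congr rfl fun j _ => ?_
  rw [map_smul]
  conv_lhs => rw [← b.sum_repr' (X (b j)), Finset.smul_sum]
  exact Finset.sum_congr rfl fun i _ => smul_comm _ _ _

omit [CompleteSpace H] [CompleteSpace K] in
lemma choi_ofChoi (C : H ⊗[ℂ] K →ₗ[ℂ] H ⊗[ℂ] K) : choi b (ofChoi b C) = C := by
  classical
  let c := stdOrthonormalBasis ℂ K
  refine (b.tensorProduct c).toBasis.ext fun q => ?_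
  refine InnerProductSpace.ext_inner_left_basis (b.tensorProduct c).toBasis fun p => ?_
  simp only [OrthonormalBasis.coe_toBasis, OrthonormalBasis.tensorProduct_apply']
  rw [inner_choi, ← inner_slice]
  congr 2
  change ∑ i, ∑ j, _ = _
  simp only [inner_right_rankOne_apply, b.inner_eq_ite]
  rw [Finset.sum_eq_single p.1, Finset.sum_eq_single q.1]
  · simp
  · intro j' _ h
    simp [h.symm]
  · simp
  · intro i' _ h
    simp [h]
  · simp

omit [FiniteDimensional ℂ H] [CompleteSpace H] [FiniteDimensional ℂ K] [CompleteSpace K] in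
lemma inner_apply_of_choi {C : H ⊗[ℂ] K →ₗ[ℂ] H ⊗[ℂ] K} {Φ : (H →L[ℂ] H) →ₗ[ℂ] (K →L[ℂ] K)}
    (hΦ : choi b Φ = C) (X : H →L[ℂ] H) (k k' : K) :
    ⟪k, Φ X k'⟫_ℂ = ∑ i, ∑ j, ⟪b i, X (b j)⟫_ℂ * ⟪b i ⊗ₜ[ℂ] k, C (b j ⊗ₜ[ℂ] k')⟫_ℂ := by
  conv_lhs => rw [eq_sum_rankOne b X]
  simp only [map_sum, map_smul, sum_apply, smul_apply,
    inner_sum, inner_smul_right]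
  refine Finset.sum_congr rfl fun i _ => Finset.sum_congr rfl fun j _ => ?_
  rw [← hΦ, inner_choi]

omit [CompleteSpace H] [CompleteSpace K] in
lemma choi_eq_iff (C : H ⊗[ℂ] K →ₗ[ℂ] H ⊗[ℂ] K) (Φ : (H →L[ℂ] H) →ₗ[ℂ] (K →L[ℂ] K)) :
    choi b Φ = C ↔ Φ = ofChoi b C := by
  refine ⟨fun h => ?_, fun h => h ▸ choi_ofChoi b C⟩
  refine LinearMap.ext fun X => ContinuousLinearMap.ext fun k' => ext_inner_left ℂ fun k => ?_
  rw [inner_apply_of_choi b h, inner_apply_of_choi b (choi_ofChoi b C)]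

lemma inner_smul_smul {E : Type*} [NormedAddCommGroup E] [InnerProductSpace ℂ E] (c c' : ℂ)
    (x y : E) : ⟪c • x, c' • y⟫_ℂ = star c * (c' * ⟪x, y⟫_ℂ) := by
  rw [inner_smul_left, inner_smul_right]
  rfl

omit [FiniteDimensional ℂ H] [CompleteSpace H] [FiniteDimensional ℂ K] [CompleteSpace K] in
lemma inner_sum_tmul {d : ℕ} (C : H ⊗[ℂ] K →ₗ[ℂ] H ⊗[ℂ] K) (u : Fin d → ι → ℂ) (f : Fin d → K) :
    ⟪∑ j, (∑ a, u j a • b a) ⊗ₜ[ℂ] f j, C (∑ j, (∑ a, u j a • b a) ⊗ₜ[ℂ] f j)⟫_ℂ =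
      ∑ i, ∑ j, ∑ a, ∑ a', (star (u i a) * u j a') * ⟪b a ⊗ₜ[ℂ] f i, C (b a' ⊗ₜ[ℂ] f j)⟫_ℂ := by
  simp only [TensorProduct.sum_tmul, ← TensorProduct.smul_tmul', map_sum, map_smul]
  simp only [sum_inner]
  simp only [inner_sum]
  refine Finset.sum_congr rfl fun i _ => ?_
  rw [Finset.sum_comm]
  refine Finset.sum_congr rfl fun j _ => Finset.sum_congr rfl fun a _ =>
    Finset.sum_congr rfl fun a' _ => ?_
  rw [mul_assoc]
  exact inner_smul_smul (E := H ⊗[ℂ] K) _ _ _ _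

lemma sum_comm_four {α β γ δ π M : Type*} [Fintype α] [Fintype β] [Fintype γ] [Fintype δ] [Fintype π]
    [AddCommMonoid M] (F : α → β → γ → δ → π → M) :
    ∑ i, ∑ j, ∑ k, ∑ l, ∑ p, F i j k l p = ∑ p, ∑ i, ∑ j, ∑ k, ∑ l, F i j k l p :=
  (Finset.sum_congr rfl fun _ _ => (Finset.sum_congr rfl fun _ _ =>
    (Finset.sum_congr rfl fun _ _ => Finset.sum_comm).trans Finset.sum_comm).trans
      Finset.sum_comm).trans Finset.sum_comm

omit [FiniteDimensional ℂ H] [FiniteDimensional ℂ K] in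
/-- `d`-positivity through vectors of Schmidt rank at most `d`. -/
lemma isDPositive_iff {C : H ⊗[ℂ] K →ₗ[ℂ] H ⊗[ℂ] K} {Φ : (H →L[ℂ] H) →ₗ[ℂ] (K →L[ℂ] K)}
    (hΦ : choi b Φ = C) (d : ℕ) :
    IsDPositive d Φ ↔ ∀ (η : Fin d → H) (ζ : Fin d → K),
      0 ≤ ⟪∑ i, η i ⊗ₜ[ℂ] ζ i, C (∑ i, η i ⊗ₜ[ℂ] ζ i)⟫_ℂ := by
  constructor
  · intro h η ζ
    -- Coordinates are conjugated because `|u i⟩⟨u j|` conjugates its second vector, whereas the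
    -- quadratic form of `C` conjugates the first.
    let u : Fin d → H := fun i => ∑ a, star ⟪b a, η i⟫_ℂ • b a
    let M : CStarMatrix (Fin d) (Fin d) (H →L[ℂ] H) :=
      CStarMatrix.ofMatrix fun i j => rankOne ℂ (u i) (u j)
    have hM : 0 ≤ M := by
      refine cstarMatrix_nonneg_of_inner fun g => ?_
      have : ∑ i, ∑ j, ⟪g i, M i j (g j)⟫_ℂ = (∑ i, ⟪g i, u i⟫_ℂ) * star (∑ j, ⟪g j, u j⟫_ℂ) := by
        rw [star_sum, Finset.sum_mul_sum]
        refine Finset.sum_congr rfl fun i _ => Finset.sum_congr rfl fun j _ => ?_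
        refine (inner_right_rankOne_apply _ _ _ _).trans (congrArg _ ?_)
        exact (inner_conj_symm _ _).symm
      rw [this]
      exact mul_star_self_nonneg _
    have hpos := inner_nonneg_of_cstarMatrix_nonneg (h M hM) ζ
    have hη : ∀ i, η i = ∑ a, ⟪b a, η i⟫_ℂ • b a := fun i => (b.sum_repr' _).symm
    have hu : ∀ i a, ⟪b a, u i⟫_ℂ = star ⟪b a, η i⟫_ℂ := fun i a => by
      classical
      simp [u, b.inner_eq_ite]
    have hv : ∑ i, η i ⊗ₜ[ℂ] ζ i = ∑ i, (∑ a, ⟪b a, η i⟫_ℂ • b a) ⊗ₜ[ℂ] ζ i :=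
      Finset.sum_congr rfl fun i _ => congrArg (· ⊗ₜ[ℂ] ζ i) (hη i)
    rw [hv, inner_sum_tmul b C (fun i a => ⟪b a, η i⟫_ℂ)]
    refine hpos.trans_eq ?_
    refine Finset.sum_congr rfl fun i _ => Finset.sum_congr rfl fun j _ => ?_
    rw [CStarMatrix.map_apply, inner_apply_of_choi b hΦ]
    refine Finset.sum_congr rfl fun a _ => Finset.sum_congr rfl fun a' _ => ?_
    refine congrArg (· * _) ?_
    refine (inner_right_rankOne_apply _ _ _ _).trans ?_
    rw [hu, ← inner_conj_symm (u j), hu]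
    exact congrArg _ (star_star _)
  · intro h M hM
    refine cstarMatrix_nonneg_of_inner fun f => ?_
    simp only [CStarMatrix.map_apply]
    refine cstarMatrix_induction_nonneg
      (p := fun M => 0 ≤ ∑ i, ∑ j, ⟪f i, Φ (M i j) (f j)⟫_ℂ) ?_ ?_ ?_ hM
    · simp
    · intro M M' h h'
      simp only [CStarMatrix.add_apply, map_add, add_apply, inner_add_right,
        Finset.sum_add_distrib]
      exact add_nonneg h h'
    · intro B
      have key : ∀ i j, ⟪f i, Φ ((star B * B) i j) (f j)⟫_ℂ = ∑ a, ∑ a', ∑ p : Fin d × ι,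
          ⟪B p.1 i (b a), b p.2⟫_ℂ * ⟪b p.2, B p.1 j (b a')⟫_ℂ *
            ⟪b a ⊗ₜ[ℂ] f i, C (b a' ⊗ₜ[ℂ] f j)⟫_ℂ := by
        intro i j
        rw [inner_apply_of_choi b hΦ]
        refine Finset.sum_congr rfl fun a _ => Finset.sum_congr rfl fun a' _ => ?_
        rw [inner_star_mul_self_apply, Finset.sum_mul, Fintype.sum_prod_type]
        refine Finset.sum_congr rfl fun k _ => ?_
        rw [← b.sum_inner_mul_inner, Finset.sum_mul]
      -- Resolving the identity between `B*` and `B` by the basis splits the form into one term for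
      -- each row of `B` and basis vector, each the form of `C` at a sum of `d` product vectors.
      have hsum : ∑ i, ∑ j, ⟪f i, Φ ((star B * B) i j) (f j)⟫_ℂ = ∑ p : Fin d × ι,
          ⟪∑ j, (∑ a, ⟪b p.2, B p.1 j (b a)⟫_ℂ • b a) ⊗ₜ[ℂ] f j,
            C (∑ j, (∑ a, ⟪b p.2, B p.1 j (b a)⟫_ℂ • b a) ⊗ₜ[ℂ] f j)⟫_ℂ := by
        simp only [key]
        rw [sum_comm_four]
        refine Finset.sum_congr rfl fun p _ => ?_
        rw [inner_sum_tmul b C fun j a => ⟪b p.2, B p.1 j (b a)⟫_ℂ]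
        refine Finset.sum_congr rfl fun i _ => Finset.sum_congr rfl fun j _ =>
          Finset.sum_congr rfl fun a _ => Finset.sum_congr rfl fun a' _ => ?_
        rw [← inner_conj_symm (B p.1 i (b a))]
        rfl
      rw [hsum]
      exact Finset.sum_nonneg fun p _ => h _ _

omit [FiniteDimensional ℂ H] [FiniteDimensional ℂ K] in
lemma isCompletelyPositive_iff (Φ : (H →L[ℂ] H) →ₗ[ℂ] (K →L[ℂ] K)) :
    IsCompletelyPositive Φ ↔ ∀ d, IsDPositive d Φ := by
  constructor
  · rintro ⟨Ψ, hΨ⟩ d M hM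
    have h := Ψ.map_cstarMatrix_nonneg' d M hM
    have : M.map Φ = M.map Ψ.toLinearMap := CStarMatrix.ext fun i j => (hΨ _).symm
    rwa [this]
  · intro h
    exact ⟨⟨Φ, h⟩, fun _ => rfl⟩

omit [FiniteDimensional ℂ H] [FiniteDimensional ℂ K] in
/-- Choi's theorem. -/
lemma isCompletelyPositive_iff_choi {C : H ⊗[ℂ] K →ₗ[ℂ] H ⊗[ℂ] K}
    {Φ : (H →L[ℂ] H) →ₗ[ℂ] (K →L[ℂ] K)} (hΦ : choi b Φ = C) :
    IsCompletelyPositive Φ ↔ ∀ v, 0 ≤ ⟪v, C v⟫_ℂ := by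
  rw [isCompletelyPositive_iff]
  refine ⟨fun h v => ?_, fun h d => (isDPositive_iff b hΦ d).2 fun η ζ => h _⟩
  -- Every tensor is a finite sum of product vectors; `d` is taken to be the number of summands.
  obtain ⟨S, rfl⟩ := TensorProduct.exists_finset v
  have := (isDPositive_iff b hΦ _).1 (h S.card) (fun i => (S.equivFin.symm i).1.1)
    (fun i => (S.equivFin.symm i).1.2)
  have e : ∑ i, (S.equivFin.symm i).1.1 ⊗ₜ[ℂ] (S.equivFin.symm i).1.2 =
      ∑ i ∈ S, i.1 ⊗ₜ[ℂ] i.2 := by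
    rw [S.equivFin.symm.sum_comp (fun i : S => i.1.1 ⊗ₜ[ℂ] i.1.2),
      Finset.sum_coe_sort S (fun i => i.1 ⊗ₜ[ℂ] i.2)]
  rwa [e] at this

end Choi

/-! ### Schmidt rank estimates -/

section Schmidt
open scoped InnerProductSpace

variable {V H K : Type*} [NormedAddCommGroup H] [InnerProductSpace ℂ H]
  [NormedAddCommGroup K] [InnerProductSpace ℂ K] [NormedAddCommGroup V] [InnerProductSpace ℂ V]

/-- Expand the first legs in an orthonormal basis of their span, whose dimension is at most `d`. -/
lemma exists_orthonormal_sum_tmul {d : ℕ} (η : Fin d → H) (ζ : Fin d → K) :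
    ∃ n ≤ d, ∃ (e : Fin n → H) (ζ' : Fin n → K), Orthonormal ℂ e ∧
      ∑ i, η i ⊗ₜ[ℂ] ζ i = ∑ j, e j ⊗ₜ[ℂ] ζ' j := by
  let W : Submodule ℂ H := Submodule.span ℂ (Set.range η)
  have : FiniteDimensional ℂ W := FiniteDimensional.span_of_finite ℂ (Set.finite_range η)
  let e := stdOrthonormalBasis ℂ W
  refine ⟨Module.finrank ℂ W, ?_, fun j => (e j : H),
    fun j => ∑ i, ⟪(e j : H), η i⟫_ℂ • ζ i, ?_, ?_⟩
  · exact (finrank_range_le_card (R := ℂ) η).trans_eq (Fintype.card_fin d)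
  · exact e.orthonormal.comp_linearIsometry W.subtypeₗᵢ
  · simp only [TensorProduct.tmul_sum, TensorProduct.tmul_smul, TensorProduct.smul_tmul']
    rw [Finset.sum_comm]
    refine Finset.sum_congr rfl fun i _ => ?_
    rw [← TensorProduct.sum_tmul]
    congr 1
    have hi : η i ∈ W := Submodule.subset_span (Set.mem_range_self i)
    have := congrArg (Subtype.val) (e.sum_repr' ⟨η i, hi⟩)
    simpa using this.symm

lemma norm_sq_sum_tmul_of_orthonormal {n : ℕ} {e : Fin n → H} (he : Orthonormal ℂ e)
    (ζ : Fin n → K) : ‖∑ j, e j ⊗ₜ[ℂ] ζ j‖ ^ 2 = ∑ j, ‖ζ j‖ ^ 2 := by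
  have h : (⟪∑ j, e j ⊗ₜ[ℂ] ζ j, ∑ j, e j ⊗ₜ[ℂ] ζ j⟫_ℂ) = ((∑ j, ‖ζ j‖ ^ 2 : ℝ) : ℂ) := by
    simp only [sum_inner, inner_sum, TensorProduct.inner_tmul, orthonormal_iff_ite.1 he]
    push_cast
    refine Finset.sum_congr rfl fun j _ => ?_
    rw [Finset.sum_eq_single j]
    · rw [if_pos rfl, one_mul, inner_self_eq_norm_sq_to_K]; rfl
    · intro i _ hi
      simp [hi]
    · simp
  exact (inner_self_eq_norm_sq (𝕜 := ℂ) _).symm.trans ((congrArg Complex.re h).trans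
    (Complex.ofReal_re _))

/-- With orthonormal first legs, the triangle inequality gives the sum of the norms of the second
legs, and Cauchy-Schwarz turns it into an `ℓ²` norm at the price of `d`. -/
lemma norm_sq_apply_sum_tmul_le {d : ℕ} (B : H ⊗[ℂ] K →ₗ[ℂ] V)
    (hB : ∀ η ζ, ‖B (η ⊗ₜ[ℂ] ζ)‖ ≤ ‖η‖ * ‖ζ‖) (η : Fin d → H) (ζ : Fin d → K) :
    ‖B (∑ i, η i ⊗ₜ[ℂ] ζ i)‖ ^ 2 ≤ d * ‖∑ i, η i ⊗ₜ[ℂ] ζ i‖ ^ 2 := by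
  obtain ⟨n, hn, e, ζ', he, h⟩ := exists_orthonormal_sum_tmul η ζ
  rw [h, norm_sq_sum_tmul_of_orthonormal he, map_sum]
  have h1 : ‖∑ j, B (e j ⊗ₜ[ℂ] ζ' j)‖ ≤ ∑ j, ‖ζ' j‖ := by
    refine norm_sum_le_of_le _ fun j _ => (hB _ _).trans_eq ?_
    rw [he.1, one_mul]
  have h2 : (∑ j, ‖ζ' j‖) ^ 2 ≤ n * ∑ j, ‖ζ' j‖ ^ 2 := by
    simpa using sq_sum_le_card_mul_sum_sq (s := Finset.univ) (f := fun j => ‖ζ' j‖)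
  calc _ ≤ (∑ j, ‖ζ' j‖) ^ 2 := pow_le_pow_left₀ (norm_nonneg _) h1 2
    _ ≤ n * ∑ j, ‖ζ' j‖ ^ 2 := h2
    _ ≤ d * ∑ j, ‖ζ' j‖ ^ 2 := by gcongr

end Schmidt

/-! ### Coordinates of the three-vertices -/

section Coordinates
open scoped InnerProductSpace
open Matrix

variable {N l m a b : ℕ}

/-- The coordinates of an element of `(ℂ^N)^{⊗ l} ⊗ (ℂ^N)^{⊗ m}`. -/
def coords (w : TPow N l ⊗[ℂ] TPow N m) : Matrix (Fin l → Fin N) (Fin m → Fin N) ℂ :=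
  fun x y => ⟪stdVec x ⊗ₜ[ℂ] stdVec y, w⟫_ℂ

lemma inner_stdVec {k : ℕ} (x : Fin k → Fin N) (u : TPow N k) : ⟪stdVec x, u⟫_ℂ = u x := by
  simp [stdVec, EuclideanSpace.inner_single_left]

lemma coords_tmul (u : TPow N l) (v : TPow N m) :
    coords (u ⊗ₜ[ℂ] v) = vecMulVec u v := by
  ext x y
  rw [coords, TensorProduct.inner_tmul, inner_stdVec, inner_stdVec, vecMulVec_apply]

lemma coords_add (w w' : TPow N l ⊗[ℂ] TPow N m) : coords (w + w') = coords w + coords w' := by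
  ext x y
  exact inner_add_right _ _ _

lemma coords_zero : coords (0 : TPow N l ⊗[ℂ] TPow N m) = 0 := by
  ext x y
  exact inner_zero_right _

lemma inner_eq_frobInner (w w' : TPow N l ⊗[ℂ] TPow N m) :
    ⟪w, w'⟫_ℂ = frobInner (coords w) (coords w') := by
  rw [← ((EuclideanSpace.basisFun (Fin l → Fin N) ℂ).tensorProduct
    (EuclideanSpace.basisFun (Fin m → Fin N) ℂ)).sum_inner_mul_inner, Fintype.sum_prod_type]
  refine Finset.sum_congr rfl fun x _ => Finset.sum_congr rfl fun y _ => ?_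
  rw [OrthonormalBasis.tensorProduct_apply, EuclideanSpace.basisFun_apply,
    EuclideanSpace.basisFun_apply, ← inner_conj_symm w]
  rfl

lemma norm_sq_eq_frobSq (w : TPow N l ⊗[ℂ] TPow N m) : ‖w‖ ^ 2 = frobSq (coords w) := by
  rw [← inner_self_eq_norm_sq (𝕜 := ℂ), inner_eq_frobInner, frobInner_self]
  exact Complex.ofReal_re _

lemma jwOp_apply {k : ℕ} (u : TPow N k) : (jwOp N k u).ofLp = jonesWenzl N k *ᵥ u.ofLp := rfl

lemma jwBoth_vecMulVec (u : (Fin l → Fin N) → ℂ) (v : (Fin m → Fin N) → ℂ) :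
    jwBoth (vecMulVec u v) = vecMulVec (jonesWenzl N l *ᵥ u) (jonesWenzl N m *ᵥ v) := by
  rw [jwBoth, mul_vecMulVec, vecMulVec_mul, ← mulVec_transpose, jonesWenzl_transpose]

lemma coords_map_jwOp (w : TPow N l ⊗[ℂ] TPow N m) :
    coords (TensorProduct.map (jwOp N l) (jwOp N m) w) = jwBoth (coords w) := by
  induction w with
  | zero => rw [map_zero, coords_zero, jwBoth, Matrix.mul_zero, Matrix.zero_mul]
  | tmul u v => rw [TensorProduct.map_tmul, coords_tmul, coords_tmul, jwBoth_vecMulVec, jwOp_apply,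
      jwOp_apply]
  | add w w' h h' =>
    rw [map_add, coords_add, coords_add, h, h', jwBoth, jwBoth, jwBoth, Matrix.mul_add,
      Matrix.add_mul]

/-- The condition for the coefficient of `insertT` to be `1`. -/
def Matching (k l m r : ℕ) (x : Fin l → Fin N) (y : Fin m → Fin N) (z : Fin k → Fin N) : Prop :=
  (∀ (i : Fin k) (j : Fin l), (j : ℕ) + r < l → (i : ℕ) = j → z i = x j) ∧
    (∀ (i : Fin k) (j : Fin m), r ≤ (j : ℕ) → (i : ℕ) + 2 * r = l + j → z i = y j) ∧
    (∀ (i : Fin l) (j : Fin m), (j : ℕ) < r → (i : ℕ) + j + 1 = l → x i = y j)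

instance (k l m r : ℕ) (x : Fin l → Fin N) (y : Fin m → Fin N) :
    DecidablePred (Matching k l m r x y) := fun _ => by unfold Matching; infer_instance

lemma matching_zero (x : Fin a → Fin N) (y : Fin b → Fin N) (z : Fin (a + b) → Fin N) :
    Matching (a + b) a b 0 x y z ↔ z = Fin.append x y := by
  constructor
  · rintro ⟨h1, h2, -⟩
    funext i
    refine Fin.addCases (fun i => ?_) (fun i => ?_) i
    · rw [Fin.append_left]
      exact h1 _ i (by simp) (by simp)
    · rw [Fin.append_right]
      exact h2 _ i (by simp) (by simp)
  · rintro rfl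
    refine ⟨fun i j _ hij => ?_, fun i j _ hij => ?_, fun i j hj => by omega⟩
    · obtain rfl : i = Fin.castAdd b j := Fin.ext hij
      rw [Fin.append_left]
    · obtain rfl : i = Fin.natAdd a j := Fin.ext (by simpa using hij)
      rw [Fin.append_right]

/-- Peels off the innermost cup, joining the last letter of `x` to the first of `y`, as `insertCup`
does. It makes the closed formula of `insertT` agree with the recursive insertion. -/
lemma matching_succ (r : ℕ) (x : Fin (a + r + 1) → Fin N) (y : Fin (b + r + 1) → Fin N)
    (z : Fin (a + b) → Fin N) :
    Matching (a + b) (a + r + 1) (b + r + 1) (r + 1) x y z ↔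
      x (Fin.last (a + r)) = y 0 ∧
        Matching (a + b) (a + r) (b + r) r (Fin.init x) (Fin.tail y) z := by
  constructor
  · rintro ⟨h1, h2, h3⟩
    refine ⟨h3 _ _ (by simp) (by simp), fun i j hj hij => ?_, fun i j hj hij => ?_,
      fun i j hj hij => ?_⟩
    · exact h1 i j.castSucc (by simp only [Fin.val_castSucc]; omega) (by simpa using hij)
    · exact h2 i j.succ (by simp only [Fin.val_succ]; omega) (by simp only [Fin.val_succ]; omega)
    · exact h3 i.castSucc j.succ (by simp only [Fin.val_succ]; omega)
        (by simp only [Fin.val_succ, Fin.val_castSucc]; omega)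
  · rintro ⟨h0, h1, h2, h3⟩
    refine ⟨fun i j hj hij => ?_, fun i j hj hij => ?_, fun i j hj hij => ?_⟩
    · have := h1 i ⟨j, by omega⟩ (by simp only; omega) hij
      exact this
    · induction j using Fin.cases with
      | zero => simp at hj
      | succ j =>
        simp only [Fin.val_succ] at hj hij
        exact h2 i j (by omega) (by omega)
    · induction j using Fin.cases with
      | zero =>
        obtain rfl : i = Fin.last (a + r) := Fin.ext (by simp at hij ⊢; omega)
        exact h0
      | succ j =>
        simp only [Fin.val_succ] at hj hij
        exact h3 ⟨i, by omega⟩ j (by omega) (by simp only; omega)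

lemma insertCups_eq_sum (ξ : (Fin (a + b) → Fin N) → ℂ) (r : ℕ) (x : Fin (a + r) → Fin N)
    (y : Fin (b + r) → Fin N) :
    insertCups ξ r x y = ∑ z with Matching (a + b) (a + r) (b + r) r x y z, ξ z := by
  induction r with
  | zero =>
    have : Finset.univ.filter (Matching (a + b) (a + 0) (b + 0) 0 x y) = {Fin.append x y} := by
      ext z
      rw [Finset.mem_filter, Finset.mem_singleton]
      exact (and_iff_right (Finset.mem_univ z)).trans (matching_zero x y z)
    rw [this, Finset.sum_singleton]
    rfl
  | succ r ih =>
    have h : ∀ z, Matching (a + b) (a + (r + 1)) (b + (r + 1)) (r + 1) x y z ↔ _ :=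
      matching_succ r x y
    simp only [h]
    change (if x (Fin.last (a + r)) = y (0 : Fin (b + r + 1)) then
      insertCups ξ r (Fin.init (n := a + r) x) (Fin.tail (n := b + r) y) else 0) = _
    split_ifs with h0
    · rw [ih]
      simp only [h0, true_and]
    · simp only [h0, false_and, Finset.filter_false, Finset.sum_empty]

lemma coords_insertT (r : ℕ) (ξ : TPow N (a + b)) :
    coords (insertT N (a + b) (a + r) (b + r) r ξ) = insertCups ξ.ofLp r := by
  ext x y
  rw [insertCups_eq_sum]
  simp only [coords, insertT, LinearMap.sum_apply, inner_sum]
  have e : ∀ (x' : Fin (a + r) → Fin N) (y' : Fin (b + r) → Fin N) (z : Fin (a + b) → Fin N),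
      ⟪stdVec x ⊗ₜ[ℂ] stdVec y, ((innerSL ℂ (stdVec z) : TPow N (a + b) →ₗ[ℂ] ℂ).smulRight
        (stdVec x' ⊗ₜ[ℂ] stdVec y')) ξ⟫_ℂ = if x = x' ∧ y = y' then ξ z else 0 := by
    intro x' y' z
    have h1 : ((innerSL ℂ (stdVec z) : TPow N (a + b) →ₗ[ℂ] ℂ).smulRight
        (stdVec x' ⊗ₜ[ℂ] stdVec y')) ξ = ξ z • (stdVec x' ⊗ₜ[ℂ] stdVec y') := by
      rw [← inner_stdVec]
      rfl
    rw [h1, inner_smul_right (E := TPow N (a + r) ⊗[ℂ] TPow N (b + r)), TensorProduct.inner_tmul, inner_stdVec, inner_stdVec]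
    simp only [stdVec, PiLp.single_apply]
    by_cases hx : x = x' <;> by_cases hy : y = y' <;> simp [hx, hy]
  simp only [e]
  rw [Finset.sum_eq_single x, Finset.sum_eq_single y]
  · simp only [and_self, if_true]
    exact Finset.sum_congr (Finset.filter_congr_decidable ..) fun _ _ => rfl
  · intro y' _ h
    simp [h.symm]
  · simp
  · intro x' _ h
    simp [h.symm]
  · simp

end Coordinates

/-! ### The three-vertices -/

section ThreeVertex
open scoped InnerProductSpace
open Matrix

variable {N a b : ℕ}

/-- The inclusion of `H_k` as an isometry. -/
def jwInclIso (N k : ℕ) : HSpace N k →ₗᵢ[ℂ] TPow N k := ⟨jwIncl N k, fun _ => rfl⟩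

lemma capFree_jwIncl (hN : 3 ≤ N) {k : ℕ} (ξ : HSpace N k) : CapFree (jwIncl N k ξ).ofLp := by
  obtain ⟨u, hu⟩ := ξ.2
  have : (jwIncl N k ξ).ofLp = jonesWenzl N k *ᵥ u.ofLp := by
    rw [← jwOp_apply, hu]
    rfl
  rw [this]
  exact capFree_jonesWenzl_mulVec hN _

/-- Cap-free tensors as elements of `H_k`. -/
def CapFree.toHSpace {k : ℕ} {v : (Fin k → Fin N) → ℂ} (hv : CapFree v) : HSpace N k :=
  ⟨WithLp.toLp 2 v, WithLp.toLp 2 v, congrArg (WithLp.toLp 2) hv.jonesWenzl_mulVec⟩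

lemma CapFree.jwIncl_toHSpace {k : ℕ} {v : (Fin k → Fin N) → ℂ} (hv : CapFree v) :
    (jwIncl N k hv.toHSpace).ofLp = v := rfl

lemma map_jwIncl_threeVertex (k l m r : ℕ) (ξ : HSpace N k) :
    TensorProduct.map (jwIncl N l) (jwIncl N m) (threeVertex N k l m r ξ) =
      TensorProduct.map (jwOp N l) (jwOp N m) (insertT N k l m r (jwIncl N k ξ)) := by
  rw [threeVertex, LinearMap.comp_apply, LinearMap.comp_apply, ← LinearMap.comp_apply,
    ← TensorProduct.map_comp]
  rfl

lemma coords_threeVertex (r : ℕ) (ξ : HSpace N (a + b)) :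
    coords (TensorProduct.map (jwIncl N (a + r)) (jwIncl N (b + r))
      (threeVertex N (a + b) (a + r) (b + r) r ξ)) =
        jwBoth (insertCups (jwIncl N (a + b) ξ).ofLp r) := by
  rw [map_jwIncl_threeVertex, coords_map_jwOp, coords_insertT]

lemma inner_map_jwIncl {l m : ℕ} (w w' : HSpace N l ⊗[ℂ] HSpace N m) :
    ⟪TensorProduct.map (jwIncl N l) (jwIncl N m) w,
      TensorProduct.map (jwIncl N l) (jwIncl N m) w'⟫_ℂ = ⟪w, w'⟫_ℂ :=
  TensorProduct.inner_map_map (jwInclIso N l) (jwInclIso N m) w w'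

lemma norm_map_jwIncl {l m : ℕ} (w : HSpace N l ⊗[ℂ] HSpace N m) :
    ‖TensorProduct.map (jwIncl N l) (jwIncl N m) w‖ = ‖w‖ :=
  TensorProduct.norm_map (jwInclIso N l) (jwInclIso N m) w

lemma norm_eq_l2norm {k : ℕ} (ξ : HSpace N k) : ‖ξ‖ = l2norm (jwIncl N k ξ).ofLp :=
  EuclideanSpace.norm_eq (jwIncl N k ξ)

lemma norm_sq_threeVertex (hN : 3 ≤ N) (r : ℕ) (ξ : HSpace N (a + b)) :
    ‖threeVertex N (a + b) (a + r) (b + r) r ξ‖ ^ 2 =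
      (∏ s ∈ Finset.range r, thetaStep (qParam N) a b s) * ‖ξ‖ ^ 2 := by
  rw [← norm_map_jwIncl, norm_sq_eq_frobSq, coords_threeVertex,
    frobSq_jwBoth_insertCups hN (capFree_jwIncl hN ξ), norm_eq_l2norm, l2norm_sq]

/-- The self-adjoint projections move onto `η ⊗ ζ`, which they fix, so they disappear from the
pairing. -/
lemma inner_threeVertex_tmul (hN : 3 ≤ N) (r : ℕ) (ξ : HSpace N (a + b)) (η : HSpace N (a + r))
    (ζ : HSpace N (b + r)) :
    ⟪threeVertex N (a + b) (a + r) (b + r) r ξ, η ⊗ₜ[ℂ] ζ⟫_ℂ =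
      frobInner (insertCups (jwIncl N (a + b) ξ).ofLp r)
        (vecMulVec (jwIncl N (a + r) η).ofLp (jwIncl N (b + r) ζ).ofLp) := by
  rw [← inner_map_jwIncl, inner_eq_frobInner, coords_threeVertex, TensorProduct.map_tmul,
    coords_tmul, frobInner_jwBoth, jwBoth_vecMulVec, (capFree_jwIncl hN η).jonesWenzl_mulVec,
    (capFree_jwIncl hN ζ).jonesWenzl_mulVec]

lemma norm_inner_threeVertex_tmul_le (hN : 3 ≤ N) (r : ℕ) (ξ : HSpace N (a + b))
    (η : HSpace N (a + r)) (ζ : HSpace N (b + r)) :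
    ‖⟪threeVertex N (a + b) (a + r) (b + r) r ξ, η ⊗ₜ[ℂ] ζ⟫_ℂ‖ ≤ ‖ξ‖ * (‖η‖ * ‖ζ‖) := by
  have hs : ∀ {k : ℕ} (v : (Fin k → Fin N) → ℂ), l2norm (star v) = l2norm v := fun v => by
    simp [l2norm]
  rw [inner_threeVertex_tmul hN, norm_eq_l2norm, norm_eq_l2norm η, norm_eq_l2norm ζ,
    ← hs (jwIncl N (a + r) η).ofLp, ← hs (jwIncl N (b + r) ζ).ofLp]
  refine le_trans (le_of_eq ?_) (norm_sum_insertCups_le _ r _ _)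
  rw [← norm_star, frobInner]
  simp only [star_sum, star_mul', star_star, vecMulVec_apply]
  rfl

end ThreeVertex

/-! ### Multiples of isometries -/

section Homothety
open scoped InnerProductSpace ComplexOrder

variable {V E : Type*} [NormedAddCommGroup V] [InnerProductSpace ℂ V] [FiniteDimensional ℂ V]
  [NormedAddCommGroup E] [InnerProductSpace ℂ E] [FiniteDimensional ℂ E] {A : V →ₗ[ℂ] E} {ρ : ℝ}

lemma norm_sq_adjoint_eq_inner (A : V →ₗ[ℂ] E) (v : E) :
    (‖LinearMap.adjoint A v‖ ^ 2 : ℂ) = ⟪A (LinearMap.adjoint A v), v⟫_ℂ := by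
  rw [← LinearMap.adjoint_inner_right]
  exact (inner_self_eq_norm_sq_to_K (𝕜 := ℂ) (LinearMap.adjoint A v)).symm

lemma norm_sq_adjoint_eq_norm_inner (A : V →ₗ[ℂ] E) (v : E) :
    ‖LinearMap.adjoint A v‖ ^ 2 = ‖⟪A (LinearMap.adjoint A v), v⟫_ℂ‖ := by
  rw [← norm_sq_adjoint_eq_inner, norm_pow, Complex.norm_real, norm_norm]

/-- From `‖A* v‖² = ⟪A A* v, v⟫ ≤ √ρ ‖A* v‖ ‖v‖`, divided by `‖A* v‖` when it is nonzero. -/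
lemma norm_sq_adjoint_le (hρ : 0 ≤ ρ) (hA : ∀ ξ, ‖A ξ‖ ^ 2 = ρ * ‖ξ‖ ^ 2) (v : E) :
    ‖LinearMap.adjoint A v‖ ^ 2 ≤ ρ * ‖v‖ ^ 2 := by
  have h1 : ‖LinearMap.adjoint A v‖ ^ 2 ≤ ‖A (LinearMap.adjoint A v)‖ * ‖v‖ := by
    rw [norm_sq_adjoint_eq_norm_inner]
    exact norm_inner_le_norm _ _
  have h2 := hA (LinearMap.adjoint A v)
  rcases (norm_nonneg (LinearMap.adjoint A v)).eq_or_lt with h0 | h0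
  · simpa [← h0] using mul_nonneg hρ (sq_nonneg ‖v‖)
  · have h3 : (‖LinearMap.adjoint A v‖ ^ 2) ^ 2 ≤ ρ * ‖LinearMap.adjoint A v‖ ^ 2 * ‖v‖ ^ 2 := by
      rw [← h2, ← mul_pow]
      exact pow_le_pow_left₀ (by positivity) h1 2
    have h4 : 0 < ‖LinearMap.adjoint A v‖ ^ 2 := by positivity
    nlinarith

lemma norm_adjoint_tmul_le {H K : Type*} [NormedAddCommGroup H] [InnerProductSpace ℂ H]
    [FiniteDimensional ℂ H] [NormedAddCommGroup K] [InnerProductSpace ℂ K] [FiniteDimensional ℂ K]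
    {A : V →ₗ[ℂ] H ⊗[ℂ] K} (hA : ∀ ξ η ζ, ‖⟪A ξ, η ⊗ₜ[ℂ] ζ⟫_ℂ‖ ≤ ‖ξ‖ * (‖η‖ * ‖ζ‖)) (η : H) (ζ : K) :
    ‖LinearMap.adjoint A (η ⊗ₜ[ℂ] ζ)‖ ≤ ‖η‖ * ‖ζ‖ := by
  have h := hA (LinearMap.adjoint A (η ⊗ₜ[ℂ] ζ)) η ζ
  rw [← norm_sq_adjoint_eq_norm_inner, sq] at h
  rcases (norm_nonneg (LinearMap.adjoint A (η ⊗ₜ[ℂ] ζ))).eq_or_lt with h0 | h0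
  · rw [← h0]
    positivity
  · exact le_of_mul_le_mul_left h h0

/-- The operator `1 - t α α^*`, where `α` is the normalization of `A`, as a quadratic form. -/
lemma inner_sub_smul_comp_adjoint_nonneg_iff {c : ℝ} (hc : c ^ 2 = ρ⁻¹) (hρ : 0 < ρ) (t : ℝ)
    (v : E) : (0 ≤ ⟪v, (LinearMap.id - (t : ℂ) •
      (((c : ℂ) • A) ∘ₗ LinearMap.adjoint ((c : ℂ) • A)) : E →ₗ[ℂ] E) v⟫_ℂ) ↔ t * ‖LinearMap.adjoint A v‖ ^ 2 ≤ ρ * ‖v‖ ^ 2 := by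
  have h1 : ⟪v, A (LinearMap.adjoint A v)⟫_ℂ = ((‖LinearMap.adjoint A v‖ ^ 2 : ℝ) : ℂ) := by
    rw [← inner_conj_symm, ← norm_sq_adjoint_eq_inner, ← Complex.ofReal_pow, Complex.conj_ofReal]
  have h2 : ⟪v, v⟫_ℂ = ((‖v‖ ^ 2 : ℝ) : ℂ) := by
    rw [Complex.ofReal_pow]
    exact inner_self_eq_norm_sq_to_K (𝕜 := ℂ) v
  have h3 : ⟪v, (LinearMap.id - (t : ℂ) •
      (((c : ℂ) • A) ∘ₗ LinearMap.adjoint ((c : ℂ) • A)) : E →ₗ[ℂ] E) v⟫_ℂ = ((‖v‖ ^ 2 - t * (ρ⁻¹ * ‖LinearMap.adjoint A v‖ ^ 2) : ℝ) : ℂ) := by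
    have h4 : LinearMap.adjoint ((c : ℂ) • A) = (c : ℂ) • LinearMap.adjoint A := by
      rw [map_smulₛₗ, Complex.conj_ofReal]
    rw [LinearMap.sub_apply, LinearMap.id_apply, LinearMap.smul_apply, LinearMap.comp_apply,
      LinearMap.smul_apply, h4, LinearMap.smul_apply, map_smul, inner_sub_right, inner_smul_right,
      inner_smul_right, inner_smul_right, h1, h2, ← hc]
    push_cast
    ring
  rw [h3, Complex.zero_le_real, sub_nonneg, ← mul_le_mul_iff_right₀ hρ]
  rw [show ρ * (t * (ρ⁻¹ * ‖LinearMap.adjoint A v‖ ^ 2)) = t * ‖LinearMap.adjoint A v‖ ^ 2 by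
    field_simp]

/-- Vectors `A ξ` with `ξ ≠ 0` are extremal, since `‖A* A ξ‖ ≥ ρ ‖ξ‖`; they force `t ≤ 1`. -/
lemma forall_mul_norm_sq_adjoint_le_iff [Nontrivial V] (hρ : 0 < ρ)
    (hA : ∀ ξ, ‖A ξ‖ ^ 2 = ρ * ‖ξ‖ ^ 2) {t : ℝ} (ht : 0 ≤ t) :
    (∀ v, t * ‖LinearMap.adjoint A v‖ ^ 2 ≤ ρ * ‖v‖ ^ 2) ↔ t ≤ 1 := by
  constructor
  · intro h
    obtain ⟨ξ, hξ⟩ := exists_ne (0 : V)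
    have h0 : 0 < ‖ξ‖ := norm_pos_iff.2 hξ
    have h1 : ‖A ξ‖ ^ 2 ≤ ‖LinearMap.adjoint A (A ξ)‖ * ‖ξ‖ := by
      rw [← inner_self_eq_norm_sq (𝕜 := ℂ), ← LinearMap.adjoint_inner_left]
      exact re_inner_le_norm _ _
    rw [hA, sq, ← mul_assoc] at h1
    have h2 : ρ * ‖ξ‖ ≤ ‖LinearMap.adjoint A (A ξ)‖ := le_of_mul_le_mul_right h1 h0
    have h3 := h (A ξ)
    rw [hA] at h3
    have h4 : (ρ * ‖ξ‖) ^ 2 ≤ ‖LinearMap.adjoint A (A ξ)‖ ^ 2 :=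
      pow_le_pow_left₀ (by positivity) h2 2
    have h5 : t * (ρ * ‖ξ‖) ^ 2 ≤ 1 * (ρ * ‖ξ‖) ^ 2 := by
      calc _ ≤ _ := mul_le_mul_of_nonneg_left h4 ht
        _ ≤ _ := h3
        _ = _ := by ring
    exact le_of_mul_le_mul_right h5 (by positivity)
  · intro h v
    have h1 := norm_sq_adjoint_le hρ.le hA v
    have h2 : t * ‖LinearMap.adjoint A v‖ ^ 2 ≤ 1 * ‖LinearMap.adjoint A v‖ ^ 2 :=
      mul_le_mul_of_nonneg_right h (sq_nonneg _)
    linarith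

end Homothety

/-! ### Vectors of maximal overlap -/

section Overlap
open scoped InnerProductSpace
open Matrix

variable {N a b : ℕ}

lemma orthonormal_toHSpace {d k : ℕ} {x : Fin d → Fin k → Fin N} (hx : Function.Injective x)
    (hr : ∀ i, Reduced (x i)) : Orthonormal ℂ fun i => (hr i).capFree.toHSpace := by
  rw [orthonormal_iff_ite]
  intro i j
  have h : ⟪(hr i).capFree.toHSpace, (hr j).capFree.toHSpace⟫_ℂ =
      ⟪(stdVec (x i) : TPow N k), stdVec (x j)⟫_ℂ := rfl
  rw [h, inner_stdVec, stdVec, PiLp.single_apply]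
  simp only [hx.eq_iff]

lemma frobInner_vecMulVec_single {l m : ℕ} (X : Matrix (Fin l → Fin N) (Fin m → Fin N) ℂ)
    (x : Fin l → Fin N) (y : Fin m → Fin N) :
    frobInner X (vecMulVec (Pi.single x 1) (Pi.single y 1)) = star (X x y) := by
  rw [frobInner, Finset.sum_eq_single x, Finset.sum_eq_single y]
  · simp [vecMulVec_apply]
  · intro y' _ h
    simp [vecMulVec_apply, h]
  · simp
  · intro x' _ h
    simp [vecMulVec_apply, h]
  · simp

/-- Sums of `d` orthogonal product vectors whose image under the adjoint of the three-vertex is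
large. -/
lemma exists_large_overlap (hN : 3 ≤ N) (a b r : ℕ) {d : ℕ} (hd : d ≤ (N - 2) * (N - 1) ^ r) :
    ∃ (η : Fin d → HSpace N (a + (r + 1))) (ζ : Fin d → HSpace N (b + (r + 1))),
      ‖∑ i, η i ⊗ₜ[ℂ] ζ i‖ ^ 2 = d ∧
      (d : ℝ) ≤ ‖LinearMap.adjoint (threeVertex N (a + b) (a + (r + 1)) (b + (r + 1)) (r + 1))
        (∑ i, η i ⊗ₜ[ℂ] ζ i)‖ := by
  obtain ⟨z, hz, x, y, hx, hy, h⟩ := exists_reduced_words hN a b r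
  let e := Fin.castLE hd
  have he : Function.Injective e := Fin.castLE_injective hd
  have hη := orthonormal_toHSpace (hx.comp he) (fun i => (h (e i)).1)
  have hζ := orthonormal_toHSpace (hy.comp he) (fun i => (h (e i)).2.1)
  have hξ := orthonormal_toHSpace (d := 1) (x := fun _ => z) (fun i j _ => Subsingleton.elim i j)
    (fun _ => hz)
  refine ⟨fun i => (h (e i)).1.capFree.toHSpace, fun i => (h (e i)).2.1.capFree.toHSpace, ?_, ?_⟩
  · rw [norm_sq_sum_tmul_of_orthonormal hη]
    have h1 := hζ.1
    simp only [Function.comp_apply] at h1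
    simp [h1]
  · set v := ∑ i, (h (e i)).1.capFree.toHSpace ⊗ₜ[ℂ] (h (e i)).2.1.capFree.toHSpace with hv
    -- Each of the `d` product vectors contributes exactly one matching coefficient; pairing `A* v`
    -- with the unit vector of `z` then bounds its norm below.
    have h1 : ⟪threeVertex N (a + b) (a + (r + 1)) (b + (r + 1)) (r + 1) hz.capFree.toHSpace, v⟫_ℂ =
        d := by
      rw [hv, inner_sum]
      simp only [inner_threeVertex_tmul hN, CapFree.jwIncl_toHSpace, frobInner_vecMulVec_single,
        (h _).2.2.2]
      simp
    have h2 := norm_inner_le_norm (𝕜 := ℂ) hz.capFree.toHSpace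
      (LinearMap.adjoint (threeVertex N (a + b) (a + (r + 1)) (b + (r + 1)) (r + 1)) v)
    rw [LinearMap.adjoint_inner_right, h1, hξ.1 0, one_mul] at h2
    simpa using h2

lemma nontrivial_hSpace (hN : 3 ≤ N) (a b : ℕ) : Nontrivial (HSpace N (a + b)) := by
  obtain ⟨z, hz, -⟩ := exists_reduced_words hN a b 0
  have hξ := orthonormal_toHSpace (d := 1) (x := fun _ => z) (fun i j _ => Subsingleton.elim i j)
    (fun _ => hz)
  exact ⟨⟨_, 0, hξ.ne_zero 0⟩⟩

lemma norm_threeVertex_sq (hN : 3 ≤ N) (a b r : ℕ) :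
    ‖LinearMap.toContinuousLinearMap (threeVertex N (a + b) (a + r) (b + r) r)‖ ^ 2 =
      ∏ s ∈ Finset.range r, thetaStep (qParam N) a b s := by
  have := nontrivial_hSpace hN a b
  have hρ : 0 ≤ ∏ s ∈ Finset.range r, thetaStep (qParam N) a b s := by
    obtain ⟨ξ, hξ⟩ := exists_ne (0 : HSpace N (a + b))
    have h1 := norm_sq_threeVertex hN r ξ
    have h2 : 0 < ‖ξ‖ ^ 2 := by positivity
    by_contra h
    have h3 := mul_neg_of_neg_of_pos (not_le.1 h) h2
    have h4 := sq_nonneg ‖threeVertex N (a + b) (a + r) (b + r) r ξ‖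
    linarith
  rw [ContinuousLinearMap.homothety_norm (a := √(∏ s ∈ Finset.range r, thetaStep (qParam N) a b s)),
    Real.sq_sqrt hρ]
  intro ξ
  refine (pow_left_inj₀ (norm_nonneg _) (by positivity) two_ne_zero).1 ?_
  rw [mul_pow, Real.sq_sqrt hρ]
  exact norm_sq_threeVertex hN r ξ

end Overlap

end

end FreeOrth

/-! ### The positivity thresholds -/

open FreeOrth in
theorem mainTheorem7 (N k l m r : ℕ) (hN : 3 ≤ N)
    (hk : k + 2 * r = l + m) (hrl : r ≤ l) (hrm : r ≤ m) (hr : 1 ≤ r)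
    {ι : Type*} [Fintype ι] (b : OrthonormalBasis ι ℂ (HSpace N l)) (t : ℝ) (ht : 0 ≤ t) :
    ∃ Φ : (HSpace N l →L[ℂ] HSpace N l) →ₗ[ℂ] (HSpace N m →L[ℂ] HSpace N m),
      (∀ Ψ, choi b Ψ = LinearMap.id - (t : ℂ) • alphaProj N k l m r ↔ Ψ = Φ) ∧
      ∀ d : ℕ, 1 ≤ d →
        (1 < t → t ≤ theta (qParam N) k l m r / (d * qInt (qParam N) (k + 1)) →
          IsDPositive d Φ ∧ ¬ IsCompletelyPositive Φ) ∧
        (d ≤ (N - 2) * (N - 1) ^ (r - 1) →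
          ((IsDPositive d Φ ∧ ¬ IsCompletelyPositive Φ) ↔
            1 < t ∧ t ≤ theta (qParam N) k l m r / (d * qInt (qParam N) (k + 1)))) ∧
        (constC (qParam N))⁻¹ ^ 2 * (qParam N)⁻¹ ^ r * (d : ℝ)⁻¹ ≤
          theta (qParam N) k l m r / (d * qInt (qParam N) (k + 1)) := by
  have h0 := qParam_pos hN
  have h1 := qParam_lt_one hN
  obtain ⟨a, rfl⟩ : ∃ a, l = a + r := ⟨l - r, by omega⟩
  obtain ⟨c, rfl⟩ : ∃ c, m = c + r := ⟨m - r, by omega⟩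
  obtain rfl : k = a + c := by omega
  have := nontrivial_hSpace hN a c
  set ρ : ℝ := ∏ s ∈ Finset.range r, thetaStep (qParam N) a c s with hρ
  have hθ : theta (qParam N) (a + c) (a + r) (c + r) r / qInt (qParam N) (a + c + 1) = ρ :=
    theta_div_eq_prod h0 h1 a c r
  have hρ0 : 0 < ρ := Finset.prod_pos fun s _ => div_pos
    (mul_pos (qInt_succ_pos h0 h1 _) (qInt_succ_pos h0 h1 _))
    (mul_pos (qInt_succ_pos h0 h1 _) (qInt_succ_pos h0 h1 _))
  have hdiv : ∀ d : ℕ, theta (qParam N) (a + c) (a + r) (c + r) r /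
      (d * qInt (qParam N) (a + c + 1)) = ρ / d := fun d => by
    rw [← hθ, div_div, mul_comm]
  set A := threeVertex N (a + c) (a + r) (c + r) r with hA
  have hnorm : (‖LinearMap.toContinuousLinearMap A‖⁻¹) ^ 2 = ρ⁻¹ := by
    rw [inv_pow, norm_threeVertex_sq hN]
  have hAξ : ∀ ξ, ‖A ξ‖ ^ 2 = ρ * ‖ξ‖ ^ 2 := norm_sq_threeVertex hN r
  have hquad := inner_sub_smul_comp_adjoint_nonneg_iff (A := A) hnorm hρ0 t
  have hΦ := choi_ofChoi b (LinearMap.id - (t : ℂ) • alphaProj N (a + c) (a + r) (c + r) r)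
  set Φ := ofChoi b (LinearMap.id - (t : ℂ) • alphaProj N (a + c) (a + r) (c + r) r)
  have hCP : IsCompletelyPositive Φ ↔ t ≤ 1 :=
    (isCompletelyPositive_iff_choi b hΦ).trans
      ((forall_congr' hquad).trans (forall_mul_norm_sq_adjoint_le_iff hρ0 hAξ ht))
  have hdpos : ∀ d, IsDPositive d Φ ↔ ∀ (η : Fin d → HSpace N (a + r)) (ζ : Fin d → HSpace N (c + r)),
      t * ‖LinearMap.adjoint A (∑ i, η i ⊗ₜ[ℂ] ζ i)‖ ^ 2 ≤ ρ * ‖∑ i, η i ⊗ₜ[ℂ] ζ i‖ ^ 2 := fun d =>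
    (isDPositive_iff b hΦ d).trans (forall_congr' fun η => forall_congr' fun ζ => hquad _)
  refine ⟨Φ, choi_eq_iff b _, fun d hd => ?_⟩
  have hd0 : (0 : ℝ) < d := by exact_mod_cast hd
  rw [hdiv]
  have hsuff : t ≤ ρ / d → IsDPositive d Φ := fun h => (hdpos d).2 fun η ζ => by
    have h2 := norm_sq_apply_sum_tmul_le (LinearMap.adjoint A)
      (norm_adjoint_tmul_le (norm_inner_threeVertex_tmul_le hN r)) η ζ
    calc _ ≤ ρ / d * (d * ‖∑ i, η i ⊗ₜ[ℂ] ζ i‖ ^ 2) := by gcongr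
      _ = _ := by field_simp
  refine ⟨fun ht1 h => ⟨hsuff h, fun h' => absurd (hCP.1 h') (not_le.2 ht1)⟩, fun hdN => ?_, ?_⟩
  · rw [hCP, not_le]
    refine ⟨fun h => ⟨h.2, ?_⟩, fun h => ⟨hsuff h.2, h.1⟩⟩
    -- The letter next to the fixed word has `N - 2` choices and the other `r - 1` inserted letters
    -- have `N - 1` each, whence the exponent.
    obtain ⟨r, rfl⟩ : ∃ s, r = s + 1 := ⟨r - 1, by omega⟩
    obtain ⟨η, ζ, hv, hle⟩ := exists_large_overlap hN a c r hdN
    have h2 := (hdpos d).1 h.1 η ζ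
    rw [hv] at h2
    -- Here `‖v‖² = d` while `‖A* v‖ ≥ d`, so one factor `d` survives the division.
    have h3 : t * (d : ℝ) ^ 2 ≤ ρ * d := by
      refine le_trans ?_ h2
      gcongr
    rw [le_div_iff₀ hd0]
    refine le_of_mul_le_mul_right ?_ hd0
    linarith
  · rw [← hθ, div_eq_mul_inv _ (d : ℝ)]
    exact mul_le_mul_of_nonneg_right (constC_bound h0 h1 a c r) (by positivity)
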